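/- A strict partition is a finite strictly decreasing sequence $\bar\lambda=(\bar\lambda_1>\dots>\bar\lambda_\ell)$ of positive integers (possibly empty). Its shifted Young diagram is the set of boxes $(i,j)$ ($i$ the row, $j$ the column) with $1\le i\le \ell$ and $i+1\le j\le i+\bar\lambda_i$. Its doubled distinct partition $\bar\lambda\bar\lambda$ is the usual partition whose Young diagram is obtained from the shifted Young diagram by adding, for each $1\le i\le\ell$, $\bar\lambda_i$ boxes at the bottom of column $i$, namely $(i,i),(i+1,i),\dots,(i+\bar\lambda_i-1,i)$; it has size $2\sum_i\bar\lambda_i$. For a usual partition $\lambda$ let $|\lambda|$ be its size, let $H(\lambda)$ be the product of the hook lengths of all boxes of its Young diagram (the hook length of a box being the number of boxes to its right in the same row, plus the number of boxes below it in the same column, plus $1$), and let $\mathcal C(\lambda)$ be the multiset of the contents $j-i$ of its boxes $(i,j)$. For an integer $x$ and an integer $r\ge 0$ put $\binom{x}{r}=x(x-1)\cdots(x-r+1)/r!$. **Theorem.** For all integers $n\ge 0$ and $k\ge 0$, $$2^{n}\,n!\sum_{|\bar\lambda\bar\lambda|=2n}\frac{1}{H(\bar\lambda\bar\lambda)}\sum_{c\in\mathcal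 C(\bar\lambda\bar\lambda)}\binom{c+k-1}{2k}=\frac{2^{k+1}}{(k+1)!}\binom{n}{k+1},$$ and, for all integers $n\ge 0$, $$2^{n}\,n!\sum_{|\bar\lambda\bar\lambda|=2n}\frac{1}{H(\bar\lambda\bar\lambda)}\sum_{c\in\mathcal C(\bar\lambda\bar\lambda)}c^{2}=4\binom{n}{2}+n,$$ where the outer sums run over all doubled distinct partitions of size $2n$. -/

import Mathlib

/-- A strict partition: a finite strictly decreasing sequence of positive integers. -/
structure StrictPartition where
  parts : List ℕ
  strictlyDecreasing : parts.Pairwise (· > ·)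
  pos : ∀ x ∈ parts, 0 < x

namespace StrictPartition

/-- The `i`-th part (counted from `0`), with value `0` past the length. -/
def part (s : StrictPartition) (i : ℕ) : ℕ := s.parts.getD i 0

/-- The shifted Young diagram, in matrix coordinates counted from `0`: row `i` consists of
`s.part i` boxes, the leftmost of which is the box `(i, i + 1)`. -/
def shiftedCells (s : StrictPartition) : Finset (ℕ × ℕ) :=
  (Finset.range s.parts.length).biUnion fun i =>
    (Finset.Icc (i + 1) (i + s.part i)).image fun j => (i, j)

/-- The boxes added to the shifted Young diagram: `s.part i` boxes in column `i`, placed directly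
below the boxes `(0, i), …, (i - 1, i)` of the shifted diagram in that column. -/
def addedCells (s : StrictPartition) : Finset (ℕ × ℕ) :=
  (Finset.range s.parts.length).biUnion fun i =>
    (Finset.Ico i (i + s.part i)).image fun r => (r, i)

theorem part_eq_zero (s : StrictPartition) {i : ℕ} (h : s.parts.length ≤ i) : s.part i = 0 := by
  simp [part, List.getD_eq_getElem?_getD, h]

theorem mem_shiftedCells (s : StrictPartition) (a b : ℕ) :
    (a, b) ∈ s.shiftedCells ↔ a < b ∧ b ≤ a + s.part a := by
  simp only [shiftedCells, Finset.mem_biUnion, Finset.mem_range, Finset.mem_image,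
    Finset.mem_Icc, Prod.mk.injEq]
  constructor
  · rintro ⟨i, _, j, hj, rfl, rfl⟩
    omega
  · rintro ⟨h1, h2⟩
    refine ⟨a, ?_, b, ⟨by omega, h2⟩, rfl, rfl⟩
    by_contra hlen
    have := s.part_eq_zero (not_lt.mp hlen)
    omega

theorem mem_addedCells (s : StrictPartition) (a b : ℕ) :
    (a, b) ∈ s.addedCells ↔ b ≤ a ∧ a < b + s.part b := by
  simp only [addedCells, Finset.mem_biUnion, Finset.mem_range, Finset.mem_image,
    Finset.mem_Ico, Prod.mk.injEq]
  constructor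
  · rintro ⟨i, _, j, hj, rfl, rfl⟩
    omega
  · rintro ⟨h1, h2⟩
    refine ⟨b, ?_, a, ⟨h1, h2⟩, rfl, rfl⟩
    by_contra hlen
    have := s.part_eq_zero (not_lt.mp hlen)
    omega

theorem part_add_le (s : StrictPartition) {i j : ℕ} (hij : i ≤ j) (hj : 0 < s.part j) :
    s.part j + j ≤ s.part i + i := by
  induction j, hij using Nat.le_induction with
  | base => exact le_rfl
  | succ j hij ih =>
    have hlen : j + 1 < s.parts.length := by
      by_contra h
      have := s.part_eq_zero (not_lt.mp h)
      omega
    have h1 : s.part (j + 1) < s.part j := by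
      have := List.pairwise_iff_getElem.mp s.strictlyDecreasing j (j + 1) (by omega) hlen
        (Nat.lt_succ_self j)
      simpa [part, List.getD_eq_getElem?_getD, hlen, Nat.lt_of_succ_lt hlen] using this
    have := ih (by omega)
    omega

/-- The doubled distinct partition of a strict partition, as a Young diagram: `s.part i` boxes
are added to column `i` of the shifted Young diagram, for every `i`. -/
def doubled (s : StrictPartition) : YoungDiagram where
  cells := s.shiftedCells ∪ s.addedCells
  isLowerSet := by
    rintro ⟨a, b⟩ ⟨a', b'⟩ ⟨ha, hb⟩ h
    simp only at ha hb
    simp only [Finset.coe_union, Set.mem_union, Finset.mem_coe, mem_shiftedCells,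
      mem_addedCells] at h ⊢
    by_cases hlt : a' < b'
    · left
      rcases h with h | h
      · have := s.part_add_le ha (by omega)
        omega
      · have := s.part_add_le (i := a') (j := b) (by omega) (by omega)
        omega
    · right
      rcases h with h | h
      · have := s.part_add_le (i := b') (j := a) (by omega) (by omega)
        omega
      · have := s.part_add_le hb (by omega)
        omega

end StrictPartition

namespace YoungDiagram

/-- A doubled distinct partition is the doubled distinct partition of some strict partition. -/
def IsDoubledDistinct (μ : YoungDiagram) : Prop := ∃ s : StrictPartition, s.doubled = μ

theorem finite_card_eq (m : ℕ) : {μ : YoungDiagram | μ.card = m}.Finite := by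
  refine Set.Finite.of_finite_image (f := fun μ : YoungDiagram => μ.cells)
    (Set.Finite.subset (Finset.finite_toSet (Finset.range m ×ˢ Finset.range m).powerset) ?_)
    (fun μ _ ν _ h => YoungDiagram.ext h)
  rintro _ ⟨μ, rfl, rfl⟩
  simp only [Finset.mem_coe, Finset.mem_powerset]
  rintro ⟨i, j⟩ hij
  have hrow : (Finset.range (j + 1)).card ≤ μ.card :=
    Finset.card_le_card_of_injOn (fun b => (i, b))
      (fun b hb => μ.up_left_mem le_rfl (by simpa [Nat.lt_succ_iff] using hb) hij)
      (fun b _ c _ h => by simpa using h)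
  have hcol : (Finset.range (i + 1)).card ≤ μ.card :=
    Finset.card_le_card_of_injOn (fun a => (a, j))
      (fun a ha => μ.up_left_mem (by simpa [Nat.lt_succ_iff] using ha) le_rfl hij)
      (fun b _ c _ h => by simpa using h)
  simp only [Finset.card_range] at hrow hcol
  simp only [Finset.mem_product, Finset.mem_range]
  omega

/-- The finite set of all doubled distinct partitions of size `m`. -/
noncomputable def doubledDistinct (m : ℕ) : Finset YoungDiagram :=
  ((finite_card_eq m).subset (t := {μ | μ.IsDoubledDistinct ∧ μ.card = m})
    fun _ h => And.right h).toFinset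

/-- The hook length of the box `c = (i, j)` of `μ`: the number of boxes to the right of `c` in
its row, plus the number of boxes below `c` in its column, plus one. -/
def hookLength (μ : YoungDiagram) (c : ℕ × ℕ) : ℕ :=
  (μ.rowLen c.1 - (c.2 + 1)) + (μ.colLen c.2 - (c.1 + 1)) + 1

/-- The product of all hook lengths. -/
def hookProduct (μ : YoungDiagram) : ℕ := ∏ c ∈ μ.cells, μ.hookLength c

/-- The multiset of contents `j - i` of the boxes `(i, j)`. -/
def contents (μ : YoungDiagram) : Multiset ℤ :=
  μ.cells.val.map fun c => (c.2 : ℤ) - (c.1 : ℤ)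

end YoungDiagram

/-!
Strict partitions are encoded by their finite sets `S` of positive parts. The hook product of the
doubled distinct partition of `S` is `∏ 2 s! ^ 2 · ∏ ((s + t) / (s - t)) ^ 2`, the products over the
parts and over the unordered pairs of distinct parts (`StrictPartition.inv_hookProduct_doubled`).
Hence the outer sums are averages with respect to the shifted Plancherel measure, and the inner sums
are, by the symmetry between the contents `-t` and `t + 1`, combinations of the observables
`p_k (S) = ∑ s ∈ S, (s + k).choose (2 * k + 1)`.

Consecutive shifted Plancherel measures are linked by a Markov growth process
(`ShiftedPlancherel.total_succ`). Its transition probabilities are residues of the rational function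
`∏ (z - s (s - 1)) / (z ∏ (z - s (s + 1)))`, and the identities behind it are partial fraction
expansions. By Newton's identities (`ShiftedPlancherel.moment_succ`), the moments of the transition
measure are polynomials in the power sums `∑ ((s (s + 1)) ^ j - (s (s - 1)) ^ j)`. Adding a box to a
part `x` changes the `j`-th power sum by a polynomial of degree `j - 1` in `x (x + 1)`. Consequently
the difference operator `E[g (next)] - g` strictly lowers the degree in these power sums
(`ShiftedPlancherel.avg_one_sub_mem_filt`), and the average of an observable of degree `d` is a
polynomial in `n` of degree at most `d`.

The observable `p_k` has degree `k + 1`. Its average vanishes for `n ≤ k`, because all parts are then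
at most `k`, and for `n = k + 1` only the one-part partition contributes. A polynomial of degree
`k + 1` with these values is `2 ^ k / (k + 1)! · n.choose (k + 1)`
(`ShiftedPlancherel.total_chooseSum`). The sum of the squares of the contents is `4 p_1 + p_0`.
-/

namespace ShiftedPlancherel

open Finset Polynomial

/-! ### Content parameters and partial fractions -/

/-- The content parameter `t (t + 1)`, attached to the step from a part `t` to a part `t + 1`. -/
def ξ (t : ℕ) : ℚ := t * (t + 1)

/-- The content parameter `t (t - 1)`, attached to the step from a part `t` to a part `t - 1`;
for `t > 0` it is `ξ (t - 1)`. -/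
def η (t : ℕ) : ℚ := t * (t - 1)

theorem ξ_zero : ξ 0 = 0 := by simp [ξ]

theorem η_zero : η 0 = 0 := by simp [η]

theorem η_succ (t : ℕ) : η (t + 1) = ξ t := by simp [η, ξ]; ring

theorem ξ_injective : Function.Injective ξ := by
  refine StrictMono.injective fun a b h => ?_
  have : (a : ℚ) < b := by exact_mod_cast h
  have : (0 : ℚ) ≤ a := by positivity
  unfold ξ
  nlinarith

theorem η_injOn {S : Finset ℕ} (hS : 0 ∉ S) : Set.InjOn η S := by
  intro a ha b hb h
  obtain ⟨a, rfl⟩ : ∃ a', a = a' + 1 := Nat.exists_eq_succ_of_ne_zero (by rintro rfl; exact hS ha)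
  obtain ⟨b, rfl⟩ : ∃ b', b = b' + 1 := Nat.exists_eq_succ_of_ne_zero (by rintro rfl; exact hS hb)
  rw [η_succ, η_succ] at h
  rw [ξ_injective h]

/-- Adding a box to the strict partition with set of parts `S`: the part `x` becomes `x + 1`.
For `x = 0` a new part `1` is created. Intended for `x ∈ insert 0 S` with `x + 1 ∉ S`. -/
def addBox (S : Finset ℕ) (x : ℕ) : Finset ℕ := insert (x + 1) (S.erase x)

/-- The transition probability from `S` to `addBox S x` in the shifted Plancherel growth process.
As a function of `ξ x` it is the residue at `ξ x` of `∏ (z - η t) / (z ∏ (z - ξ t))`, products over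
the nonzero `t ∈ S`, so it vanishes when the box cannot be added. -/
def upWeight (S : Finset ℕ) (x : ℕ) : ℚ :=
  (∏ t ∈ S.erase 0, (ξ x - η t)) / ∏ t ∈ (insert 0 S).erase x, (ξ x - ξ t)

/-- The ratio `g (S \ box) / g S`, where `g S` is the number of standard shifted tableaux of shape
`S` divided by `(∑ s ∈ S, s)!`, and the box is removed from the part `y`. It is `-1/2` times the
residue at `η y` of `∏ (z - ξ t) / (z - η t)`, so it vanishes when the box cannot be removed. -/
def downWeight (S : Finset ℕ) (y : ℕ) : ℚ :=
  y * ∏ t ∈ S.erase y, (η y - ξ t) / (η y - η t)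

theorem upWeight_eq_zero {S : Finset ℕ} {x : ℕ} (h : x + 1 ∈ S) : upWeight S x = 0 := by
  rw [upWeight, prod_eq_zero (i := x + 1) (by simp [h]) (by rw [η_succ, sub_self]), zero_div]

theorem downWeight_eq_zero {S : Finset ℕ} {x : ℕ} (h : x ∈ S) :
    downWeight S (x + 1) = 0 := by
  rw [downWeight, prod_eq_zero (i := x) (by simp [h]) (by rw [η_succ, sub_self, zero_div]),
    mul_zero]

/-- The sum of the residues of `∏ (z - ξ t) / (z - η t)`, read off from the subleading
coefficients of the numerator and the denominator. -/
theorem sum_downWeight {S : Finset ℕ} (hS : 0 ∉ S) :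
    ∑ y ∈ S, downWeight S y = ((∑ s ∈ S, s : ℕ) : ℚ) := by
  rcases S.eq_empty_or_nonempty with rfl | hne
  · simp
  set P : ℚ[X] := ∏ t ∈ S, (X - C (ξ t)) - ∏ t ∈ S, (X - C (η t)) with hP
  have hcard : 0 < #S := hne.card_pos
  have hmon (f : ℕ → ℚ) : (∏ t ∈ S, (X - C (f t))).Monic := monic_prod_X_sub_C f S
  have hdeg (f : ℕ → ℚ) : (∏ t ∈ S, (X - C (f t))).degree = (#S : WithBot ℕ) := by
    rw [degree_prod]; simp
  have hPdeg : P.degree < (#S : WithBot ℕ) := by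
    rw [← hdeg ξ]
    refine degree_sub_lt_left ?_ (hmon _).ne_zero ?_
    · rw [hdeg, hdeg]
    · rw [(hmon _).leadingCoeff, (hmon _).leadingCoeff]
  -- The subleading coefficient of `P` is `-∑ (ξ s - η s) = -2 ∑ s`.
  have hcoeff : P.coeff (#S - 1) = -2 * ∑ s ∈ S, (s : ℚ) := by
    rw [hP, coeff_sub, prod_X_sub_C_coeff_card_pred _ _ hcard,
      prod_X_sub_C_coeff_card_pred _ _ hcard, mul_sum, ← sum_neg_distrib, ← sum_neg_distrib,
      ← sum_sub_distrib]
    refine sum_congr rfl fun s _ => ?_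
    simp only [ξ, η]; ring
  have heval : ∀ y ∈ S, P.eval (η y) = -2 * y * ∏ t ∈ S.erase y, (η y - ξ t) := by
    intro y hy
    simp only [hP, eval_sub, eval_prod, eval_X, eval_C]
    rw [prod_eq_zero (f := fun t => η y - η t) hy (sub_self _), sub_zero, ← mul_prod_erase _ _ hy]
    simp only [ξ, η]; ring
  rw [Lagrange.coeff_eq_sum (η_injOn hS) hPdeg] at hcoeff
  push_cast
  have h2 : (-2 : ℚ) ≠ 0 := by norm_num
  refine mul_left_cancel₀ h2 (Eq.trans ?_ hcoeff)
  rw [mul_sum]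
  refine sum_congr rfl fun y hy => ?_
  rw [heval y hy, downWeight, prod_div_distrib]
  ring

theorem insert_erase_zero (S : Finset ℕ) : insert 0 (S.erase 0) = insert 0 S := by
  ext x
  by_cases hx : x = 0 <;> simp [hx]

/-- The partial fraction decomposition of `∏ (z - η t) / (z ∏ (z - ξ t))` with cleared denominators,
written in the variable `X = 1 / z`. -/
theorem sum_upWeight_mul_prod (S : Finset ℕ) :
    ∑ x ∈ insert 0 S, C (upWeight S x) * ∏ t ∈ (insert 0 S).erase x, (1 - C (ξ t) * X) =
      ∏ t ∈ S.erase 0, (1 - C (η t) * X : ℚ[X]) := by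
  refine eq_of_infinite_eval_eq _ _ (Set.Infinite.mono ?_
    (Set.finite_singleton (0 : ℚ)).infinite_compl)
  intro w hw
  have hw : w ≠ 0 := hw
  set P : ℚ[X] := ∏ t ∈ S.erase 0, (X - C (η t)) with hP
  have hcard : #(insert 0 S) = #(S.erase 0) + 1 := by
    rw [← insert_erase_zero, card_insert_of_notMem (notMem_erase 0 S)]
  have hPdeg : P.degree < (#(insert 0 S) : WithBot ℕ) := by
    rw [hP, degree_prod, hcard]
    simp only [degree_X_sub_C, sum_const, nsmul_eq_mul, mul_one]
    exact_mod_cast Nat.lt_succ_self _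
  have hscale (T : Finset ℕ) (f : ℕ → ℚ) :
      ∏ t ∈ T, (1 - f t * w) = w ^ #T * ∏ t ∈ T, (w⁻¹ - f t) := by
    rw [← prod_const, ← prod_mul_distrib]
    exact prod_congr rfl fun t _ => by field_simp
  have key := congrArg (Polynomial.eval w⁻¹)
    (Lagrange.eq_interpolate (v := ξ) ξ_injective.injOn hPdeg)
  simp only [Lagrange.interpolate_apply, eval_finsetSum, eval_mul, eval_C, Lagrange.basis,
    eval_prod, Lagrange.basisDivisor, eval_sub, eval_X, hP] at key
  simp only [Set.mem_ofPred_eq, eval_finsetSum, eval_mul, eval_C, eval_prod, eval_sub, eval_one,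
    eval_X, hscale, key, mul_sum]
  refine sum_congr rfl fun x hx => ?_
  rw [card_erase_of_mem hx, hcard, Nat.add_sub_cancel, upWeight, prod_mul_distrib,
    prod_inv_distrib]
  ring

/-! ### Power sums and moments of the transition measure -/

/-- The supersymmetric power sums of the content parameters, which generate the algebra of
observables on strict partitions. -/
def psum (j : ℕ) (S : Finset ℕ) : ℚ := ∑ s ∈ S, (ξ s ^ j - η s ^ j)

theorem one_sub_mul_mk_pow (c : ℚ) :
    (1 - PowerSeries.C c * PowerSeries.X) * PowerSeries.mk (fun i => c ^ i) = 1 := by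
  ext n
  rcases n with _ | n
  · simp [sub_mul, mul_assoc]
  · simp [sub_mul, mul_assoc, PowerSeries.coeff_succ_X_mul, PowerSeries.coeff_one, pow_succ']

theorem one_sub_mul_mk_pow_succ (c : ℚ) :
    (1 - PowerSeries.C c * PowerSeries.X) * PowerSeries.mk (fun i => c ^ (i + 1)) =
      PowerSeries.C c := by
  have : PowerSeries.mk (fun i => c ^ (i + 1)) =
      PowerSeries.C c * PowerSeries.mk (fun i => c ^ i) := by
    ext n; simp [pow_succ']
  rw [this, mul_left_comm, one_sub_mul_mk_pow, mul_one]

theorem derivative_prod_one_sub (T : Finset ℕ) (b : ℕ → ℚ) :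
    PowerSeries.derivative ℚ (∏ t ∈ T, (1 - PowerSeries.C (b t) * PowerSeries.X)) =
      -((∏ t ∈ T, (1 - PowerSeries.C (b t) * PowerSeries.X)) *
        PowerSeries.mk fun i => ∑ t ∈ T, b t ^ (i + 1)) := by
  induction T using Finset.induction_on with
  | empty =>
    have : (PowerSeries.mk fun _ => 0) = (0 : PowerSeries ℚ) := by ext n; simp
    simp [this]
  | insert a T ha ih =>
    have hmk : (PowerSeries.mk fun i => ∑ t ∈ insert a T, b t ^ (i + 1)) =
        PowerSeries.mk (fun i => b a ^ (i + 1)) +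
          PowerSeries.mk fun i => ∑ t ∈ T, b t ^ (i + 1) := by
      ext n; simp [sum_insert ha]
    rw [prod_insert ha, Derivation.leibniz, ih, hmk]
    have h1 : PowerSeries.derivative ℚ (1 - PowerSeries.C (b a) * PowerSeries.X) =
        -PowerSeries.C (b a) := by
      simp [Derivation.leibniz]
    rw [h1]
    simp only [smul_eq_mul]
    linear_combination (∏ t ∈ T, (1 - PowerSeries.C (b t) * PowerSeries.X)) *
      one_sub_mul_mk_pow_succ (b a)

/-- The logarithmic derivative of `∏ (1 - a t X) / ∏ (1 - b t X)` is the generating function of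
the differences of power sums. -/
theorem derivative_of_mul_prod_eq (T : Finset ℕ) (a b : ℕ → ℚ) (M : PowerSeries ℚ)
    (h : M * ∏ t ∈ T, (1 - PowerSeries.C (b t) * PowerSeries.X) =
      ∏ t ∈ T, (1 - PowerSeries.C (a t) * PowerSeries.X)) :
    PowerSeries.derivative ℚ M =
      M * PowerSeries.mk fun i => ∑ t ∈ T, (b t ^ (i + 1) - a t ^ (i + 1)) := by
  have hne : ∏ t ∈ T, (1 - PowerSeries.C (b t) * PowerSeries.X) ≠ 0 := by
    refine prod_ne_zero_iff.mpr fun t _ h0 => ?_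
    simpa using congrArg PowerSeries.constantCoeff h0
  have hmk : (PowerSeries.mk fun i => ∑ t ∈ T, (b t ^ (i + 1) - a t ^ (i + 1))) =
      (PowerSeries.mk fun i => ∑ t ∈ T, b t ^ (i + 1)) -
        PowerSeries.mk fun i => ∑ t ∈ T, a t ^ (i + 1) := by
    ext n; simp
  have hd := congrArg (PowerSeries.derivative ℚ) h
  rw [Derivation.leibniz, derivative_prod_one_sub, derivative_prod_one_sub, ← h] at hd
  simp only [smul_eq_mul] at hd
  refine mul_right_cancel₀ hne ?_
  rw [hmk]
  linear_combination hd

/-- The transition operator of the growth process, weighted by the polynomial `Φ` in the content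
parameter of the added box. For `Φ = 1` it is the transition operator itself, and applied to the
constant function `1` it gives the moments of the transition measure. -/
def avg (Φ : ℚ[X]) : (Finset ℕ → ℚ) →ₗ[ℚ] (Finset ℕ → ℚ) where
  toFun g S := ∑ x ∈ insert 0 S, upWeight S x * Φ.eval (ξ x) * g (addBox S x)
  map_add' g h := by
    funext S; simp only [Pi.add_apply, mul_add, sum_add_distrib]
  map_smul' c g := by
    funext S
    simp only [Pi.smul_apply, smul_eq_mul, RingHom.id_apply, mul_sum]
    exact sum_congr rfl fun x _ => by ring

theorem avg_apply (Φ : ℚ[X]) (g : Finset ℕ → ℚ) (S : Finset ℕ) :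
    avg Φ g S = ∑ x ∈ insert 0 S, upWeight S x * Φ.eval (ξ x) * g (addBox S x) := rfl

/-- The moment generating function of the transition measure at `S` is
`∏ (1 - η t X) / (1 - ξ t X)`. -/
theorem mk_moment_mul_prod (S : Finset ℕ) :
    PowerSeries.mk (fun r => avg (X ^ r) 1 S) *
        ∏ t ∈ S.erase 0, (1 - PowerSeries.C (ξ t) * PowerSeries.X) =
      ∏ t ∈ S.erase 0, (1 - PowerSeries.C (η t) * PowerSeries.X) := by
  have hmk : PowerSeries.mk (fun r => avg (X ^ r) 1 S) =
      ∑ x ∈ insert 0 S, PowerSeries.C (upWeight S x) * PowerSeries.mk (fun r => ξ x ^ r) := by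
    ext n
    simp [avg_apply]
  have h0 : ∏ t ∈ S.erase 0, (1 - PowerSeries.C (ξ t) * PowerSeries.X) =
      ∏ t ∈ insert 0 S, (1 - PowerSeries.C (ξ t) * PowerSeries.X) := by
    rw [← insert_erase_zero, prod_insert (notMem_erase 0 S), ξ_zero]
    simp
  have key := congrArg (fun p : ℚ[X] => (p : PowerSeries ℚ)) (sum_upWeight_mul_prod S)
  simp only [← Polynomial.coeToPowerSeries.ringHom_apply, map_sum, map_mul, map_prod, map_sub,
    map_one] at key
  simp only [Polynomial.coeToPowerSeries.ringHom_apply, Polynomial.coe_C, Polynomial.coe_X] at key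
  rw [← key, hmk, h0, sum_mul]
  refine sum_congr rfl fun x hx => ?_
  rw [← mul_prod_erase _ _ hx, mul_assoc, ← mul_assoc (PowerSeries.mk _),
    mul_comm (PowerSeries.mk _), one_sub_mul_mk_pow, one_mul]

theorem moment_zero : avg 1 1 = 1 := by
  funext S
  have := congrArg PowerSeries.constantCoeff (mk_moment_mul_prod S)
  simpa [map_prod] using this

/-- Newton's identity expressing the moments of the transition measure through the power sums. -/
theorem moment_succ (r : ℕ) :
    ((r : ℚ) + 1) • avg (X ^ (r + 1)) 1 =
      ∑ p ∈ antidiagonal r, psum (p.2 + 1) * avg (X ^ p.1) 1 := by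
  funext S
  have h := congrArg (PowerSeries.coeff r)
    (derivative_of_mul_prod_eq _ _ _ _ (mk_moment_mul_prod S))
  rw [PowerSeries.coeff_derivative, PowerSeries.coeff_mul] at h
  simp only [PowerSeries.coeff_mk] at h
  simp only [Pi.smul_apply, smul_eq_mul, Finset.sum_apply, Pi.mul_apply]
  rw [mul_comm, h]
  refine sum_congr rfl fun p _ => ?_
  rw [mul_comm, psum]
  congr 1
  refine sum_subset (erase_subset _ _) fun t _ ht => ?_
  obtain rfl : t = 0 := by simp_all
  simp [ξ_zero, η_zero]

/-! ### The degree filtration -/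

/-- The functions on strict partitions that are linear combinations of monomials in the `psum j` of
weighted degree *less than* `m`, where `psum j` has degree `j`. The strict inequality makes
`filt 0` zero, which is the base case of the induction on the degree. -/
def filt (m : ℕ) : Submodule ℚ (Finset ℕ → ℚ) :=
  Submodule.span ℚ {f | ∃ ν : Multiset ℕ, ν.sum < m ∧ f = (ν.map psum).prod}

theorem monomial_mem_filt {ν : Multiset ℕ} {m : ℕ} (h : ν.sum < m) :
    (ν.map psum).prod ∈ filt m := Submodule.subset_span ⟨ν, h, rfl⟩

theorem filt_mono {m m' : ℕ} (h : m ≤ m') : filt m ≤ filt m' :=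
  Submodule.span_mono fun _ ⟨ν, hν, hf⟩ => ⟨ν, hν.trans_le h, hf⟩

theorem filt_zero : filt 0 = ⊥ := by simp [filt]

theorem one_mem_filt (m : ℕ) : 1 ∈ filt (m + 1) := by
  simpa using monomial_mem_filt (ν := 0) (m := m + 1) (by simp)

theorem psum_mul_mem_filt {m : ℕ} (j : ℕ) {g : Finset ℕ → ℚ} (hg : g ∈ filt m) :
    psum j * g ∈ filt (m + j) := by
  induction hg using Submodule.span_induction with
  | mem g hg =>
    obtain ⟨ν, hν, rfl⟩ := hg
    rw [← Multiset.prod_cons, ← Multiset.map_cons]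
    exact monomial_mem_filt (by simp; omega)
  | zero => simp
  | add f g _ _ hf hg => rw [mul_add]; exact add_mem hf hg
  | smul c g _ hg => rw [mul_smul_comm]; exact Submodule.smul_mem _ _ hg

theorem moment_mem_filt (r : ℕ) : avg (X ^ r) 1 ∈ filt (r + 1) := by
  induction r using Nat.strong_induction_on with
  | _ r ih =>
    rcases r with _ | r
    · rw [pow_zero, moment_zero]
      exact one_mem_filt 0
    · have hr : ((r : ℚ) + 1) ≠ 0 := by positivity
      rw [← Submodule.smul_mem_iff _ hr, moment_succ]
      refine sum_mem fun p hp => ?_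
      rw [HasAntidiagonal.mem_antidiagonal] at hp
      exact filt_mono (by omega) (psum_mul_mem_filt (p.2 + 1) (ih p.1 (by omega)))

theorem avg_one_mem_filt {m : ℕ} {Φ : ℚ[X]} (hΦ : Φ ∈ degreeLT ℚ m) : avg Φ 1 ∈ filt m := by
  rcases m with _ | m
  · obtain rfl : Φ = 0 := by simpa [mem_degreeLT] using hΦ
    have : avg 0 1 = 0 := by funext S; simp [avg_apply]
    rw [this]
    exact zero_mem _
  have hdeg : Φ.natDegree < m + 1 := by
    rw [mem_degreeLT] at hΦ
    rcases eq_or_ne Φ 0 with rfl | h0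
    · simp
    · exact (natDegree_lt_iff_degree_lt h0).mpr hΦ
  have : avg Φ 1 = ∑ i ∈ range (m + 1), Φ.coeff i • avg (X ^ i) 1 := by
    funext S
    simp only [avg_apply, Finset.sum_apply, Pi.smul_apply, smul_eq_mul, mul_sum, eval_pow, eval_X]
    rw [sum_comm]
    refine sum_congr rfl fun x _ => ?_
    rw [eval_eq_sum_range' hdeg, mul_sum, sum_mul]
    exact sum_congr rfl fun i _ => by ring
  rw [this]
  refine sum_mem fun i hi => Submodule.smul_mem _ _ ?_
  exact filt_mono (by have := mem_range.mp hi; omega) (moment_mem_filt i)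

/-- The polynomial `Δ` with `Δ (ξ x) = ξ (x + 1) ^ j - 2 ξ x ^ j + ξ (x - 1) ^ j`, by which `psum j`
grows when a box is added to the part `x`. The recursion comes from
`ξ (x + 1) + ξ (x - 1) = 2 ξ x + 2` and `ξ (x + 1) ξ (x - 1) = ξ x ^ 2 - 2 ξ x`. -/
noncomputable def stepPoly : ℕ → ℚ[X]
  | 0 => 0
  | 1 => 2
  | j + 2 => (2 * X + 2) * stepPoly (j + 1) - (X ^ 2 - 2 * X) * stepPoly j + 8 * X ^ (j + 1)

theorem eval_stepPoly (j x : ℕ) :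
    (stepPoly j).eval (ξ x) = ξ (x + 1) ^ j - 2 * ξ x ^ j + η x ^ j := by
  induction j using Nat.twoStepInduction with
  | zero => simp [stepPoly]; norm_num
  | one => simp [stepPoly, ξ, η]; ring
  | more j h0 h1 =>
    simp only [stepPoly, eval_add, eval_sub, eval_mul, eval_pow, eval_X, eval_ofNat, h0, h1]
    simp only [ξ, η, pow_succ]
    push_cast
    ring

theorem mul_mem_degreeLT {p q : ℚ[X]} {m n : ℕ} (hp : p.degree ≤ m) (hq : q ∈ degreeLT ℚ n) :
    p * q ∈ degreeLT ℚ (m + n) := by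
  rw [mem_degreeLT] at hq ⊢
  rcases eq_or_ne q 0 with rfl | hq0
  · simp
  rw [degree_mul]
  rw [degree_eq_natDegree hq0] at hq ⊢
  refine (add_le_add_left hp _).trans_lt ?_
  exact_mod_cast Nat.add_lt_add_left (by exact_mod_cast hq) m

/-- The terms of degree `j` of the second difference cancel, which is why adding a box lowers the
degree of observables. -/
theorem stepPoly_mem_degreeLT (j : ℕ) : stepPoly j ∈ degreeLT ℚ j := by
  induction j using Nat.twoStepInduction with
  | zero => exact zero_mem _
  | one =>
    rw [mem_degreeLT, stepPoly]
    exact (degree_C (by norm_num : (2 : ℚ) ≠ 0)).trans_lt (by norm_num)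
  | more j h0 h1 =>
    have hp1 : (2 * X + 2 : ℚ[X]).degree ≤ (1 : ℕ) := by compute_degree; exact le_rfl
    have hp2 : (X ^ 2 - 2 * X : ℚ[X]).degree ≤ (2 : ℕ) := by compute_degree; exact le_rfl
    have hp3 : (8 * X ^ (j + 1) : ℚ[X]).degree ≤ (j + 1 : ℕ) := by compute_degree; exact le_rfl
    rw [stepPoly]
    refine add_mem (sub_mem ?_ ?_) ?_
    · simpa only [show 1 + (j + 1) = j + 2 by omega] using mul_mem_degreeLT hp1 h1
    · simpa only [Nat.add_comm 2 j] using mul_mem_degreeLT hp2 h0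
    · exact mem_degreeLT.mpr (hp3.trans_lt (by exact_mod_cast Nat.lt_succ_self _))

theorem psum_addBox (j : ℕ) {S : Finset ℕ} {x : ℕ} (hx : x ∈ insert 0 S) (hx' : x + 1 ∉ S) :
    psum j (addBox S x) = psum j S + (stepPoly j).eval (ξ x) := by
  rw [psum, addBox, sum_insert (by simp [hx']), eval_stepPoly, η_succ]
  rcases mem_insert.mp hx with rfl | hx
  · rw [sum_erase _ (by simp [ξ_zero, η_zero]), psum, ξ_zero, η_zero]
    ring
  · rw [psum, ← add_sum_erase _ _ hx]
    ring

theorem avg_psum_mul (Φ : ℚ[X]) (j : ℕ) (g : Finset ℕ → ℚ) :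
    avg Φ (psum j * g) = psum j * avg Φ g + avg (Φ * stepPoly j) g := by
  funext S
  simp only [avg_apply, Pi.add_apply, Pi.mul_apply, mul_sum, ← sum_add_distrib, eval_mul]
  refine sum_congr rfl fun x hx => ?_
  by_cases hx' : x + 1 ∈ S
  · simp [upWeight_eq_zero hx']
  · rw [psum_addBox j hx hx']
    ring

theorem avg_mem_filt {m d : ℕ} {Φ : ℚ[X]} (hΦ : Φ ∈ degreeLT ℚ m) {g : Finset ℕ → ℚ}
    (hg : g ∈ filt (d + 1)) : avg Φ g ∈ filt (m + d) := by
  induction hg using Submodule.span_induction with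
  | zero => simp
  | add f g _ _ hf hg => rw [map_add]; exact add_mem hf hg
  | smul c g _ hg => rw [map_smul]; exact Submodule.smul_mem _ _ hg
  | mem g hg =>
    obtain ⟨ν, hν, rfl⟩ := hg
    refine filt_mono (m := m + ν.sum) (by omega) ?_
    clear hν
    induction ν using Multiset.induction generalizing m Φ with
    | empty => simpa using avg_one_mem_filt hΦ
    | cons j ν ih =>
      rw [Multiset.map_cons, Multiset.prod_cons, avg_psum_mul, Multiset.sum_cons]
      refine add_mem (filt_mono (by omega) (psum_mul_mem_filt j (ih hΦ)))
        (filt_mono (m := m + j + ν.sum) (by omega) (ih ?_))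
      exact mul_mem_degreeLT (mem_degreeLT.mp hΦ).le (stepPoly_mem_degreeLT j)

/-- The difference operator of the growth process lowers the filtration degree. -/
theorem avg_one_sub_mem_filt {m : ℕ} {g : Finset ℕ → ℚ} (hg : g ∈ filt (m + 1)) :
    avg 1 g - g ∈ filt m := by
  induction hg using Submodule.span_induction with
  | zero => simp
  | add f g _ _ hf hg => rw [map_add, add_sub_add_comm]; exact add_mem hf hg
  | smul c g _ hg => rw [map_smul, ← smul_sub]; exact Submodule.smul_mem _ _ hg
  | mem g hg =>
    obtain ⟨ν, hν, rfl⟩ := hg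
    refine filt_mono (m := ν.sum) (by omega) ?_
    clear hν
    induction ν using Multiset.induction with
    | empty => simp [moment_zero]
    | cons j ν ih =>
      rw [Multiset.map_cons, Multiset.prod_cons, avg_psum_mul, Multiset.sum_cons, one_mul,
        add_sub_right_comm, ← mul_sub]
      exact add_mem (filt_mono (by omega) (psum_mul_mem_filt j ih))
        (avg_mem_filt (stepPoly_mem_degreeLT j) (monomial_mem_filt (Nat.lt_succ_self _)))

/-! ### The shifted Plancherel measure -/

/-- The factor `|s - t| / (s + t)` for distinct parts, and `1` on the diagonal. -/
def pairFactor (s t : ℕ) : ℚ := if s = t then 1 else |(s : ℚ) - t| / (s + t)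

/-- The reciprocal of the hook product of the doubled distinct partition with set of parts `S` (see
`StrictPartition.inv_hookProduct_doubled`), as an explicit product over parts and ordered pairs of
parts. -/
def weight (S : Finset ℕ) : ℚ :=
  (∏ s ∈ S, (2 * (s.factorial : ℚ) ^ 2)⁻¹) * ∏ s ∈ S, ∏ t ∈ S, pairFactor s t

theorem weight_insert {R : Finset ℕ} {a : ℕ} (ha : a ∉ R) :
    weight (insert a R) =
      weight R * ((2 * (a.factorial : ℚ) ^ 2)⁻¹ * ∏ t ∈ R, (((a : ℚ) - t) / (a + t)) ^ 2) := by
  have h1 : (∏ t ∈ R, pairFactor a t) * ∏ s ∈ R, pairFactor s a =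
      ∏ t ∈ R, (((a : ℚ) - t) / (a + t)) ^ 2 := by
    rw [← prod_mul_distrib]
    refine prod_congr rfl fun t ht => ?_
    have hne : a ≠ t := by rintro rfl; exact ha ht
    rw [pairFactor, pairFactor, if_neg hne, if_neg hne.symm, abs_sub_comm (t : ℚ),
      add_comm (t : ℚ), div_mul_div_comm, abs_mul_abs_self, div_pow, sq, sq]
  simp only [weight, prod_insert ha, prod_mul_distrib]
  rw [show pairFactor a a = 1 by simp [pairFactor], ← h1]
  ring

/-- Detailed balance: the weight times the transition probability upwards is, up to the factor `2`,
the weight of the larger partition times the ratio downwards. -/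
theorem two_mul_weight_addBox {S : Finset ℕ} {x : ℕ} (hS : 0 ∉ S) (hx : x ∈ insert 0 S)
    (hx' : x + 1 ∉ S) :
    2 * (weight (addBox S x) * downWeight (addBox S x) (x + 1)) = weight S * upWeight S x := by
  -- `R` is the set of parts not affected by the step.
  obtain ⟨R, hR0, hRx, hRx', hadd, hcase⟩ : ∃ R : Finset ℕ, 0 ∉ R ∧ x ∉ R ∧ x + 1 ∉ R ∧
      addBox S x = insert (x + 1) R ∧ (x = 0 ∧ S = R ∨ 0 < x ∧ S = insert x R) := by
    refine ⟨S.erase x, by simp [hS], by simp, by simp [hx'], rfl, ?_⟩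
    rcases Nat.eq_zero_or_pos x with rfl | h
    · exact Or.inl ⟨rfl, (erase_eq_of_notMem hS).symm⟩
    · exact Or.inr ⟨h, (insert_erase ((mem_insert.mp hx).resolve_left h.ne')).symm⟩
  have hdown : downWeight (insert (x + 1) R) (x + 1) =
      (x + 1) * ∏ t ∈ R, ((x + 1 + t : ℚ) * (x - t)) / ((x + 1 - t) * (x + t)) := by
    rw [downWeight, erase_insert hRx', η_succ]
    push_cast
    congr 1
    refine prod_congr rfl fun t _ => ?_
    simp only [ξ, η]
    congr 1 <;> ring
  have hne : ∀ t ∈ R, (t : ℚ) ≠ 0 ∧ (x - t : ℚ) ≠ 0 ∧ (x + t : ℚ) ≠ 0 ∧ (x + 1 - t : ℚ) ≠ 0 ∧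
      (x + 1 + t : ℚ) ≠ 0 := by
    intro t ht
    have h0 : t ≠ 0 := by rintro rfl; exact hR0 ht
    have h1 : x ≠ t := by rintro rfl; exact hRx ht
    have h2 : x + 1 ≠ t := by rintro rfl; exact hRx' ht
    refine ⟨by exact_mod_cast h0, sub_ne_zero.mpr (by exact_mod_cast h1), ?_,
      sub_ne_zero.mpr (by exact_mod_cast h2), by positivity⟩
    have : (0 : ℚ) < t := by exact_mod_cast Nat.pos_of_ne_zero h0
    positivity
  rw [hadd, weight_insert hRx', hdown]
  rcases hcase with ⟨rfl, rfl⟩ | ⟨hpos, rfl⟩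
  · have hup : upWeight S 0 = ∏ t ∈ S, ((t : ℚ) - 1) / (t + 1) := by
      rw [upWeight, erase_insert hS, erase_eq_of_notMem hS, ← prod_div_distrib]
      refine prod_congr rfl fun t ht => ?_
      obtain ⟨h1, -, -, -, h2⟩ := hne t ht
      have h3 : (t + 1 : ℚ) ≠ 0 := by positivity
      rw [ξ_zero, zero_sub, zero_sub, neg_div_neg_eq]
      simp only [ξ, η]
      field_simp
    rw [hup]
    simp only [Nat.cast_zero, zero_add, Nat.factorial_one, Nat.cast_one, one_pow, one_mul]
    rw [show ∀ a b c : ℚ, 2 * (a * ((2 * 1)⁻¹ * b) * c) = a * (b * c) by intros; ring,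
      ← prod_mul_distrib]
    congr 1
    refine prod_congr rfl fun t ht => ?_
    obtain ⟨h1, h2, h3, h4, h5⟩ := hne t ht
    simp only [Nat.cast_zero, zero_add, zero_sub] at *
    have h6 : (t + 1 : ℚ) ≠ 0 := by positivity
    field_simp
    ring
  · have hxq : (x : ℚ) ≠ 0 := by exact_mod_cast hpos.ne'
    have hup : upWeight (insert x R) x =
        2 / (x + 1) * ∏ t ∈ R, ((x + 1 - t : ℚ) * (x + t)) / ((x + 1 + t) * (x - t)) := by
      rw [upWeight, erase_eq_of_notMem hS, insert_comm, erase_insert (by simp [hRx, hpos.ne']),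
        prod_insert hRx, prod_insert hR0, mul_div_mul_comm, ← prod_div_distrib]
      congr 1
      · rw [ξ_zero, sub_zero]
        simp only [ξ, η]
        field_simp
        ring
      · refine prod_congr rfl fun t _ => ?_
        simp only [ξ, η]
        congr 1 <;> ring
    rw [hup, weight_insert hRx, Nat.factorial_succ]
    push_cast
    have hf : (x.factorial : ℚ) ≠ 0 := by positivity
    have hx1 : (x + 1 : ℚ) ≠ 0 := by positivity
    have hprod : (∏ t ∈ R, ((x + 1 - t : ℚ) / (x + 1 + t)) ^ 2) *
          ∏ t ∈ R, ((x + 1 + t : ℚ) * (x - t)) / ((x + 1 - t) * (x + t)) =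
        (∏ t ∈ R, ((x - t : ℚ) / (x + t)) ^ 2) *
          ∏ t ∈ R, ((x + 1 - t : ℚ) * (x + t)) / ((x + 1 + t) * (x - t)) := by
      rw [← prod_mul_distrib, ← prod_mul_distrib]
      refine prod_congr rfl fun t ht => ?_
      obtain ⟨h1, h2, h3, h4, h5⟩ := hne t ht
      field_simp
    have hc : 2 * (2 * ((x + 1 : ℚ) * x.factorial) ^ 2)⁻¹ * (x + 1 : ℚ) =
        (2 * (x.factorial : ℚ) ^ 2)⁻¹ * (2 / (x + 1 : ℚ)) := by
      field_simp
    linear_combination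
      (weight R * (2 * (2 * ((x + 1 : ℚ) * x.factorial) ^ 2)⁻¹ * (x + 1 : ℚ))) * hprod +
      weight R * ((∏ t ∈ R, ((x - t : ℚ) / (x + t)) ^ 2) *
        ∏ t ∈ R, ((x + 1 - t : ℚ) * (x + t)) / ((x + 1 + t) * (x - t))) * hc

/-- The strict partitions of `n`, as sets of parts. -/
def strictSets (n : ℕ) : Finset (Finset ℕ) := {S ∈ (Icc 1 n).powerset | ∑ s ∈ S, s = n}

theorem mem_strictSets {n : ℕ} {S : Finset ℕ} :
    S ∈ strictSets n ↔ 0 ∉ S ∧ ∑ s ∈ S, s = n := by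
  simp only [strictSets, mem_filter, mem_powerset]
  refine and_congr_left fun h => ⟨fun hS h0 => by simpa using hS h0, fun h0 s hs => ?_⟩
  have : s ≤ ∑ s ∈ S, s := single_le_sum (f := fun s => s) (fun _ _ => Nat.zero_le _) hs
  have : s ≠ 0 := by rintro rfl; exact h0 hs
  simp; omega

/-- The average of `g` over the strict partitions of `n` with respect to the shifted Plancherel
measure. -/
def total (n : ℕ) (g : Finset ℕ → ℚ) : ℚ :=
  2 ^ n * (n.factorial : ℚ) * ∑ S ∈ strictSets n, weight S * g S

/-- Removing a box from the part `y` of `S`, which becomes `y - 1` or disappears. Inverse to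
`addBox`. -/
def removeBox (S : Finset ℕ) (y : ℕ) : Finset ℕ := (insert (y - 1) (S.erase y)).erase 0

theorem sum_addBox {n : ℕ} {S : Finset ℕ} {x : ℕ} (hS : ∑ s ∈ S, s = n) (hx : x ∈ insert 0 S)
    (hx' : x + 1 ∉ S) : ∑ s ∈ addBox S x, s = n + 1 := by
  rw [addBox, sum_insert (by simp [hx'])]
  rcases mem_insert.mp hx with rfl | hx
  · rw [sum_erase S rfl, hS]
    omega
  · have := add_sum_erase S (fun s => s) hx
    omega

theorem sum_removeBox {n : ℕ} {S : Finset ℕ} {y : ℕ} (h0 : 0 ∉ S) (hS : ∑ s ∈ S, s = n + 1)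
    (hy : y ∈ S) (hy' : y - 1 ∉ S) : ∑ s ∈ removeBox S y, s = n := by
  have hy0 : y ≠ 0 := by rintro rfl; exact h0 hy
  rw [removeBox, sum_erase (insert (y - 1) (S.erase y)) (f := fun s => s) rfl, sum_insert (by simp [hy'])]
  have := add_sum_erase S (fun s => s) hy
  omega

theorem addBox_removeBox {S : Finset ℕ} {y : ℕ} (h0 : 0 ∉ S) (hy : y ∈ S) (hy' : y - 1 ∉ S) :
    addBox (removeBox S y) (y - 1) = S := by
  ext t
  grind [addBox, removeBox]

theorem removeBox_addBox {S : Finset ℕ} {x : ℕ} (h0 : 0 ∉ S) (hx : x ∈ insert 0 S)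
    (hx' : x + 1 ∉ S) : removeBox (addBox S x) (x + 1) = S := by
  ext t
  grind [addBox, removeBox]

/-- The growth process carries the shifted Plancherel measure on partitions of `n` to the one on
partitions of `n + 1`: expand `n + 1` by `sum_downWeight` and apply detailed balance on each edge. -/
theorem total_succ (n : ℕ) (g : Finset ℕ → ℚ) : total (n + 1) g = total n (avg 1 g) := by
  -- The edges between sizes `n` and `n + 1` are counted once from above and once from below.
  have hedge : ∑ S ∈ strictSets (n + 1), ∑ y ∈ S, weight S * downWeight S y * g S =
      ∑ S ∈ strictSets n, ∑ x ∈ insert 0 S,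
        weight (addBox S x) * (if x + 1 ∈ S then 0 else downWeight (addBox S x) (x + 1)) *
          g (addBox S x) := by
    rw [sum_sigma', sum_sigma']
    rw [← sum_filter_of_ne (p := fun q : (_ : Finset ℕ) × ℕ => q.2 - 1 ∉ q.1),
      ← sum_filter_of_ne (s := (strictSets n).sigma fun S => insert 0 S)
        (p := fun q : (_ : Finset ℕ) × ℕ => q.2 + 1 ∉ q.1)]
    · refine sum_bij' (fun q _ => ⟨removeBox q.1 q.2, q.2 - 1⟩)
        (fun q _ => ⟨addBox q.1 q.2, q.2 + 1⟩) ?_ ?_ ?_ ?_ ?_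
      · rintro ⟨S, y⟩ h
        simp only [mem_filter, mem_sigma, mem_strictSets] at h ⊢
        obtain ⟨⟨⟨hS0, hSn⟩, hy⟩, hy'⟩ := h
        exact ⟨⟨⟨by simp [removeBox], sum_removeBox hS0 hSn hy hy'⟩, by grind [removeBox]⟩,
          by grind [removeBox]⟩
      · rintro ⟨S, x⟩ h
        simp only [mem_filter, mem_sigma, mem_strictSets] at h ⊢
        obtain ⟨⟨⟨hS0, hSn⟩, hx⟩, hx'⟩ := h
        exact ⟨⟨⟨by grind [addBox], sum_addBox hSn hx hx'⟩, by simp [addBox]⟩, by grind [addBox]⟩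
      · rintro ⟨S, y⟩ h
        simp only [mem_filter, mem_sigma, mem_strictSets] at h
        obtain ⟨⟨⟨hS0, hSn⟩, hy⟩, hy'⟩ := h
        have hy1 : y - 1 + 1 = y := by grind
        exact Sigma.ext (addBox_removeBox hS0 hy hy') (heq_of_eq hy1)
      · rintro ⟨S, x⟩ h
        simp only [mem_filter, mem_sigma, mem_strictSets] at h
        obtain ⟨⟨⟨hS0, hSn⟩, hx⟩, hx'⟩ := h
        exact Sigma.ext (removeBox_addBox hS0 hx hx') (heq_of_eq (Nat.add_sub_cancel x 1))
      · rintro ⟨S, y⟩ h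
        simp only [mem_filter, mem_sigma, mem_strictSets] at h
        obtain ⟨⟨⟨hS0, hSn⟩, hy⟩, hy'⟩ := h
        have hy1 : y - 1 + 1 = y := by grind
        have hyn : y ∉ removeBox S y := by grind [removeBox]
        simp only [addBox_removeBox hS0 hy hy', hy1, if_neg hyn]
    · rintro ⟨S, x⟩ - h hx
      exact h (by simp [hx])
    · rintro ⟨S, y⟩ h hne hy
      simp only [mem_sigma, mem_strictSets] at h
      have hy1 : y - 1 + 1 = y := by grind
      exact hne (by rw [← hy1, downWeight_eq_zero hy]; simp)
  have hS : ∀ S ∈ strictSets (n + 1), ((n + 1 : ℕ) : ℚ) * (weight S * g S) =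
      ∑ y ∈ S, weight S * downWeight S y * g S := by
    intro S hS
    rw [mem_strictSets] at hS
    rw [← hS.2, ← sum_downWeight hS.1, sum_mul]
    exact sum_congr rfl fun y _ => by ring
  rw [total, total, Nat.factorial_succ, Nat.cast_mul, mul_comm ((n + 1 : ℕ) : ℚ), ← mul_assoc,
    mul_assoc _ ((n + 1 : ℕ) : ℚ), mul_sum, sum_congr rfl hS, hedge, pow_succ,
    mul_right_comm (2 ^ n : ℚ), mul_assoc _ (2 : ℚ)]
  congr 1
  rw [mul_sum]
  refine sum_congr rfl fun S hS => ?_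
  rw [avg_apply, mul_sum, mul_sum]
  refine sum_congr rfl fun x hx => ?_
  split_ifs with hx'
  · simp [upWeight_eq_zero hx']
  · rw [← mul_assoc, two_mul_weight_addBox (mem_strictSets.mp hS).1 hx hx', eval_one]
    ring

theorem total_add (n : ℕ) (f g : Finset ℕ → ℚ) : total n (f + g) = total n f + total n g := by
  simp only [total, Pi.add_apply, mul_add, sum_add_distrib]

theorem total_smul (n : ℕ) (c : ℚ) (g : Finset ℕ → ℚ) : total n (c • g) = c * total n g := by
  simp only [total, Pi.smul_apply, smul_eq_mul, mul_left_comm _ c, ← mul_sum]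

theorem total_sub (n : ℕ) (f g : Finset ℕ → ℚ) : total n (f - g) = total n f - total n g := by
  simp only [total, Pi.sub_apply, mul_sub, sum_sub_distrib]

/-- Averages of observables of degree at most `m` are polynomials of degree at most `m` in `n`; such
a polynomial is determined by its zeros at `0, …, m - 1` and its value at `m`. -/
theorem total_eq_mul_choose {m : ℕ} {g : Finset ℕ → ℚ} (hg : g ∈ filt (m + 1))
    (h0 : ∀ n < m, total n g = 0) (n : ℕ) : total n g = total m g * (n.choose m : ℚ) := by
  induction m generalizing g n with
  | zero =>
    have hD := avg_one_sub_mem_filt hg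
    rw [filt_zero, Submodule.mem_bot, sub_eq_zero] at hD
    induction n with
    | zero => simp
    | succ n ih => rw [total_succ, hD, ih]; simp
  | succ m ih =>
    have hstep (n : ℕ) : total (n + 1) g = total n g + total n (avg 1 g - g) := by
      rw [total_sub, ← total_succ]; ring
    have hD := ih (avg_one_sub_mem_filt hg) fun n hn => by
      rw [total_sub, ← total_succ, h0 _ (by omega), h0 _ (by omega), sub_zero]
    have hm : total m (avg 1 g - g) = total (m + 1) g := by
      rw [hstep, h0 m (by omega), zero_add]
    induction n with
    | zero => simp [h0 0 (by omega)]
    | succ n ihn => rw [hstep, ihn, hD, hm, Nat.choose_succ_succ]; push_cast; ring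

/-! ### The binomial observables -/

/-- The sum `∑ (Φ (ξ s) - Φ (η s))` is the linear combination of the power sums whose coefficients
are those of `Φ`. -/
theorem linear_mem_filt {m : ℕ} {Φ : ℚ[X]} (hΦ : Φ ∈ degreeLT ℚ m) :
    (fun S : Finset ℕ => ∑ s ∈ S, (Φ.eval (ξ s) - Φ.eval (η s))) ∈ filt m := by
  have h : (fun S : Finset ℕ => ∑ s ∈ S, (Φ.eval (ξ s) - Φ.eval (η s))) =
      ∑ i ∈ range (Φ.natDegree + 1), Φ.coeff i • psum i := by
    funext S
    simp only [Finset.sum_apply, Pi.smul_apply, smul_eq_mul, psum, mul_sum]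
    rw [sum_comm]
    refine sum_congr rfl fun s _ => ?_
    rw [eval_eq_sum_range, eval_eq_sum_range, ← sum_sub_distrib]
    exact sum_congr rfl fun i _ => by ring
  rw [h]
  refine sum_mem fun i _ => ?_
  by_cases hi : Φ.coeff i = 0
  · rw [hi, zero_smul]
    exact zero_mem _
  · have him : i < m := by
      by_contra hcon
      exact hi (coeff_eq_zero_of_degree_lt
        ((mem_degreeLT.mp hΦ).trans_le (by exact_mod_cast not_lt.mp hcon)))
    simpa using Submodule.smul_mem _ (Φ.coeff i)
      (monomial_mem_filt (ν := {i}) (m := m) (by simpa using him))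

theorem prod_ξ_sub_ξ (s m : ℕ) :
    ∏ j ∈ range m, (ξ s - ξ j) = ((s + m).descFactorial (2 * m) : ℚ) := by
  induction m with
  | zero => simp
  | succ m ih =>
    have h1 : (s + (m + 1)).descFactorial (2 * (m + 1)) =
        (s + m + 1) * ((s + m - 2 * m) * (s + m).descFactorial (2 * m)) := by
      rw [← Nat.descFactorial_succ, ← Nat.succ_descFactorial_succ]
      rfl
    rw [prod_range_succ, ih, h1]
    rcases lt_or_ge s m with h | h
    · rw [Nat.descFactorial_of_lt (by omega)]
      simp
    · rw [show s + m - 2 * m = s - m by omega]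
      push_cast [Nat.cast_sub h]
      simp only [ξ]
      ring

/-- The binomial coefficient `(s + m).choose (2 * m)` as a polynomial in `ξ s`. -/
noncomputable def choosePoly (m : ℕ) : ℚ[X] := C ((2 * m).factorial : ℚ)⁻¹ * ∏ j ∈ range m, (X - C (ξ j))

theorem eval_choosePoly (m s : ℕ) : (choosePoly m).eval (ξ s) = ((s + m).choose (2 * m) : ℚ) := by
  rw [choosePoly, eval_mul, eval_C, eval_prod]
  simp only [eval_sub, eval_X, eval_C]
  rw [prod_ξ_sub_ξ, Nat.descFactorial_eq_factorial_mul_choose]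
  push_cast
  field_simp

theorem choosePoly_mem_degreeLT (m : ℕ) : choosePoly m ∈ degreeLT ℚ (m + 1) := by
  rw [mem_degreeLT, choosePoly]
  rw [degree_C_mul (by positivity), degree_prod]
  simp only [degree_X_sub_C, sum_const, nsmul_eq_mul, mul_one, card_range]
  exact_mod_cast Nat.lt_succ_self m

/-- Half the sum of the `(c + k - 1).choose (2 * k)` over the contents `c` of the doubled distinct
partition with set of parts `S`. -/
def chooseSum (k : ℕ) (S : Finset ℕ) : ℚ := ∑ s ∈ S, ((s + k).choose (2 * k + 1) : ℚ)

/-- The summand `(s + k).choose (2 * k + 1)` is the difference of `(s + k + 1).choose (2 * k + 2)`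
between `s` and `s - 1`, hence the difference of a polynomial of degree `k + 1` between `ξ s` and
`η s`. -/
theorem chooseSum_mem_filt (k : ℕ) : chooseSum k ∈ filt (k + 2) := by
  convert linear_mem_filt (choosePoly_mem_degreeLT (k + 1)) using 1
  funext S
  refine sum_congr rfl fun s _ => ?_
  rcases s with _ | s
  · rw [η_zero, ξ_zero, sub_self, Nat.choose_eq_zero_of_lt (by omega), Nat.cast_zero]
  · rw [η_succ, eval_choosePoly, eval_choosePoly, show s + 1 + (k + 1) = s + 1 + k + 1 by omega,
      show 2 * (k + 1) = 2 * k + 1 + 1 by omega, Nat.choose_succ_succ,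
      show s + (k + 1) = s + 1 + k by omega]
    push_cast
    ring

theorem chooseSum_eq_zero {k : ℕ} {S : Finset ℕ} (h : ∀ s ∈ S, s ≤ k) : chooseSum k S = 0 :=
  sum_eq_zero fun s hs => by
    rw [Nat.choose_eq_zero_of_lt (by have := h s hs; omega), Nat.cast_zero]

theorem le_of_mem_strictSets {n s : ℕ} {S : Finset ℕ} (hS : S ∈ strictSets n) (hs : s ∈ S) :
    s ≤ n :=
  (mem_strictSets.mp hS).2 ▸
    single_le_sum (f := fun s => s) (fun _ _ => Nat.zero_le _) hs

theorem eq_singleton_of_mem_strictSets {n : ℕ} {S : Finset ℕ} (hS : S ∈ strictSets n)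
    (hn : n ∈ S) : S = {n} := by
  obtain ⟨h0, hsum⟩ := mem_strictSets.mp hS
  have h1 : ∑ s ∈ S.erase n, s = 0 := by
    have := add_sum_erase S (fun s => s) hn
    omega
  refine eq_singleton_iff_unique_mem.mpr ⟨hn, fun s hs => ?_⟩
  by_contra hne
  have := (sum_eq_zero_iff.mp h1) s (by simp [hne, hs])
  exact h0 (this ▸ hs)

theorem total_chooseSum_of_le {n k : ℕ} (h : n ≤ k) : total n (chooseSum k) = 0 := by
  rw [total, sum_eq_zero, mul_zero]
  intro S hS
  rw [chooseSum_eq_zero fun s hs => (le_of_mem_strictSets hS hs).trans h, mul_zero]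

theorem total_succ_chooseSum (k : ℕ) :
    total (k + 1) (chooseSum k) = 2 ^ k / ((k + 1).factorial : ℚ) := by
  rw [total, sum_eq_single {k + 1}]
  · have : k + 1 + k = 2 * k + 1 := by omega
    simp only [weight, chooseSum, prod_singleton, sum_singleton, pairFactor, this,
      Nat.choose_self, if_true]
    field_simp
    push_cast
    ring
  · intro S hS hne
    rw [chooseSum_eq_zero, mul_zero]
    intro s hs
    have h1 := le_of_mem_strictSets hS hs
    have h2 : s ≠ k + 1 := by
      rintro rfl
      exact hne (eq_singleton_of_mem_strictSets hS hs)
    omega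
  · intro h
    exact absurd (mem_strictSets.mpr ⟨by simp, by simp⟩) h

theorem total_chooseSum (n k : ℕ) :
    total n (chooseSum k) = 2 ^ k / ((k + 1).factorial : ℚ) * (n.choose (k + 1) : ℚ) := by
  rw [total_eq_mul_choose (chooseSum_mem_filt k)
    (fun m hm => total_chooseSum_of_le (Nat.le_of_lt_succ hm)), total_succ_chooseSum]

end ShiftedPlancherel

namespace StrictPartition

open Finset

/-! ### Doubled diagrams -/

theorem mem_doubled (s : StrictPartition) (i j : ℕ) :
    (i, j) ∈ s.doubled ↔ i < j ∧ j ≤ i + s.part i ∨ j ≤ i ∧ i < j + s.part j := by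
  rw [← YoungDiagram.mem_cells, doubled, mem_union, mem_shiftedCells, mem_addedCells]

theorem part_mem (s : StrictPartition) {i : ℕ} (h : i < s.parts.length) : s.part i ∈ s.parts := by
  simp [part, List.getD_eq_getElem?_getD, h]

theorem part_pos_iff (s : StrictPartition) {i : ℕ} : 0 < s.part i ↔ i < s.parts.length := by
  refine ⟨fun h => ?_, fun h => s.pos _ (s.part_mem h)⟩
  by_contra hlen
  rw [s.part_eq_zero (not_lt.mp hlen)] at h
  exact lt_irrefl 0 h

theorem nodup_parts (s : StrictPartition) : s.parts.Nodup :=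
  s.strictlyDecreasing.imp fun h => Nat.ne_of_gt h

theorem card_toFinset_parts (s : StrictPartition) : #s.parts.toFinset = s.parts.length :=
  List.toFinset_card_of_nodup s.nodup_parts

theorem zero_notMem_toFinset_parts (s : StrictPartition) : 0 ∉ s.parts.toFinset := fun h =>
  lt_irrefl 0 (s.pos 0 (List.mem_toFinset.mp h))

theorem prod_part {M : Type*} [CommMonoid M] (s : StrictPartition) (f : ℕ → M) :
    ∏ i ∈ range s.parts.length, f (s.part i) = ∏ t ∈ s.parts.toFinset, f t := by
  rw [List.prod_toFinset f s.nodup_parts]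
  unfold part
  generalize s.parts = l
  induction l with
  | nil => simp
  | cons a l ih =>
    rw [List.length_cons, prod_range_succ', List.map_cons, List.prod_cons, ← ih, mul_comm]
    simp

end StrictPartition

namespace YoungDiagram

theorem rowLen_eq_of_forall {μ : YoungDiagram} {i r : ℕ} (h : ∀ j, (i, j) ∈ μ ↔ j < r) :
    μ.rowLen i = r :=
  eq_of_forall_lt_iff fun j => by rw [← mem_iff_lt_rowLen, h]

theorem colLen_eq_of_forall {μ : YoungDiagram} {j r : ℕ} (h : ∀ i, (i, j) ∈ μ ↔ i < r) :
    μ.colLen j = r :=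
  eq_of_forall_lt_iff fun i => by rw [← mem_iff_lt_colLen, h]

end YoungDiagram

namespace StrictPartition

open Finset

theorem colLen_of_lt_length (s : StrictPartition) {j : ℕ} (hj : j < s.parts.length) :
    s.doubled.colLen j = j + s.part j := by
  have hpos := s.part_pos_iff.mpr hj
  refine YoungDiagram.colLen_eq_of_forall fun i => ?_
  rw [mem_doubled]
  rcases lt_or_ge i j with hij | hij
  · have := s.part_add_le hij.le hpos
    omega
  · omega

theorem rowLen_of_lt_length (s : StrictPartition) {i : ℕ} (hi : i < s.parts.length) :
    s.doubled.rowLen i = i + s.part i + 1 := by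
  have hpos := s.part_pos_iff.mpr hi
  refine YoungDiagram.rowLen_eq_of_forall fun j => ?_
  rw [mem_doubled]
  rcases le_or_gt j i with hij | hij
  · have := s.part_add_le hij hpos
    omega
  · omega

/-- Below the rows of the shifted diagram, the doubled diagram is symmetric up to a shift by one. -/
theorem rowLen_of_length_le (s : StrictPartition) {i : ℕ} (hi : s.parts.length ≤ i) :
    s.doubled.rowLen i = s.doubled.colLen (i + 1) := by
  refine YoungDiagram.rowLen_eq_of_forall fun j => ?_
  rw [← YoungDiagram.mem_iff_lt_colLen, mem_doubled, mem_doubled, s.part_eq_zero hi,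
    s.part_eq_zero (hi.trans (Nat.le_succ i))]
  omega

variable {s s' : StrictPartition} {a : ℕ}

/-- `s` is obtained from `s'` by adding the new largest part `a`. -/
structure IsCons (a : ℕ) (s' s : StrictPartition) : Prop where
  parts_eq : s.parts = a :: s'.parts

namespace IsCons

theorem part_zero (h : IsCons a s' s) : s.part 0 = a := by simp [part, h.parts_eq]

theorem part_succ (h : IsCons a s' s) (i : ℕ) : s.part (i + 1) = s'.part i := by
  simp [part, h.parts_eq]

theorem length_eq (h : IsCons a s' s) : s.parts.length = s'.parts.length + 1 := by
  simp [h.parts_eq]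

theorem pos (h : IsCons a s' s) : 0 < a := s.pos a (by simp [h.parts_eq])

theorem lt_of_mem (h : IsCons a s' s) {t : ℕ} (ht : t ∈ s'.parts.toFinset) : t < a := by
  have := s.strictlyDecreasing
  rw [h.parts_eq] at this
  exact (List.pairwise_cons.mp this).1 t (List.mem_toFinset.mp ht)

theorem length_le (h : IsCons a s' s) : s.parts.length ≤ a := by
  have h1 := s.part_add_le (Nat.zero_le (s.parts.length - 1))
    (s.part_pos_iff.mpr (by have := h.length_eq; omega))
  have h2 := s.part_pos_iff.mpr (by have := h.length_eq; omega : s.parts.length - 1 < _)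
  rw [h.part_zero] at h1
  omega

theorem mem_succ_succ (h : IsCons a s' s) (i j : ℕ) :
    (i + 1, j + 1) ∈ s.doubled ↔ (i, j) ∈ s'.doubled := by
  rw [mem_doubled, mem_doubled, h.part_succ, h.part_succ]
  omega

theorem mem_zero_left (h : IsCons a s' s) (j : ℕ) : (0, j) ∈ s.doubled ↔ j < a + 1 := by
  have := h.pos
  rw [mem_doubled, h.part_zero]
  rcases j with _ | j
  · rw [h.part_zero]; omega
  · omega

theorem mem_zero_right (h : IsCons a s' s) (i : ℕ) : (i, 0) ∈ s.doubled ↔ i < a := by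
  have := h.pos
  rw [mem_doubled, h.part_zero]
  omega

theorem rowLen_zero (h : IsCons a s' s) : s.doubled.rowLen 0 = a + 1 :=
  YoungDiagram.rowLen_eq_of_forall h.mem_zero_left

theorem colLen_zero (h : IsCons a s' s) : s.doubled.colLen 0 = a :=
  YoungDiagram.colLen_eq_of_forall h.mem_zero_right

theorem hookLength_succ (h : IsCons a s' s) {i j : ℕ} (hij : (i, j) ∈ s'.doubled) :
    s.doubled.hookLength (i + 1, j + 1) = s'.doubled.hookLength (i, j) := by
  have hr : s.doubled.rowLen (i + 1) = s'.doubled.rowLen i + 1 := by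
    refine YoungDiagram.rowLen_eq_of_forall fun j' => ?_
    rcases j' with _ | j'
    · have h1 : (i + 1, 0 + 1) ∈ s.doubled :=
        (h.mem_succ_succ i 0).mpr (s'.doubled.up_left_mem le_rfl (Nat.zero_le j) hij)
      exact iff_of_true (s.doubled.up_left_mem le_rfl (Nat.zero_le _) h1) (Nat.succ_pos _)
    · rw [h.mem_succ_succ, YoungDiagram.mem_iff_lt_rowLen]
      omega
  have hc : s.doubled.colLen (j + 1) = s'.doubled.colLen j + 1 := by
    refine YoungDiagram.colLen_eq_of_forall fun i' => ?_
    rcases i' with _ | i'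
    · have h1 : (0 + 1, j + 1) ∈ s.doubled :=
        (h.mem_succ_succ 0 j).mpr (s'.doubled.up_left_mem (Nat.zero_le i) le_rfl hij)
      exact iff_of_true (s.doubled.up_left_mem (Nat.zero_le _) le_rfl h1) (Nat.succ_pos _)
    · rw [h.mem_succ_succ, YoungDiagram.mem_iff_lt_colLen]
      omega
  simp only [YoungDiagram.hookLength, hr, hc]
  omega

/-- The diagram of `s` consists of its first row, its first column and a diagonally shifted copy of
the diagram of `s'`. -/
@[to_additive]
theorem prod_cells {M : Type*} [CommMonoid M] (h : IsCons a s' s) (f : ℕ × ℕ → M) :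
    ∏ c ∈ s.doubled.cells, f c =
      (∏ j ∈ range (a + 1), f (0, j)) * (∏ i ∈ Ico 1 a, f (i, 0)) *
        ∏ c ∈ s'.doubled.cells, f (c.1 + 1, c.2 + 1) := by
  have hcells : s.doubled.cells = (range (a + 1)).image (fun j => (0, j)) ∪
      (Ico 1 a).image (fun i => (i, 0)) ∪
        s'.doubled.cells.image (fun c => (c.1 + 1, c.2 + 1)) := by
    ext ⟨i, j⟩
    rw [YoungDiagram.mem_cells]
    rcases i with _ | i
    · rw [h.mem_zero_left]
      simp
    · rcases j with _ | j
      · rw [h.mem_zero_right]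
        simp
      · rw [h.mem_succ_succ]
        simp
  rw [hcells, prod_union, prod_union, prod_image, prod_image, prod_image]
  · rintro ⟨i, j⟩ - ⟨i', j'⟩ - hij
    simpa using hij
  · exact fun _ _ _ _ hij => by simpa using hij
  · exact fun _ _ _ _ hij => by simpa using hij
  · rw [disjoint_left]
    rintro ⟨i, j⟩ h1 h2
    simp only [mem_image, mem_range, mem_Ico, Prod.mk.injEq] at h1 h2
    obtain ⟨_, _, rfl, -⟩ := h1
    obtain ⟨_, h3, rfl, -⟩ := h2
    omega
  · rw [disjoint_left]
    rintro ⟨i, j⟩ h1 h2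
    simp only [mem_union, mem_image, mem_range, mem_Ico, Prod.mk.injEq] at h1 h2
    omega

theorem hookLength_zero_zero (h : IsCons a s' s) : s.doubled.hookLength (0, 0) = 2 * a := by
  have := h.pos
  simp only [YoungDiagram.hookLength, h.rowLen_zero, h.colLen_zero]
  omega

theorem hookLength_zero_left (h : IsCons a s' s) {j : ℕ} (hj : j ≤ a) :
    s.doubled.hookLength (0, j) = a - j + s.doubled.colLen j := by
  have : 0 < s.doubled.colLen j := by
    rw [← YoungDiagram.mem_iff_lt_colLen, h.mem_zero_left]
    omega
  simp only [YoungDiagram.hookLength, h.rowLen_zero]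
  omega

theorem hookLength_zero_right (h : IsCons a s' s) {i : ℕ} (hi : i < a) :
    s.doubled.hookLength (i, 0) = a - (i + 1) + s.doubled.rowLen i := by
  have : 0 < s.doubled.rowLen i := by
    rw [← YoungDiagram.mem_iff_lt_rowLen, h.mem_zero_right]
    omega
  simp only [YoungDiagram.hookLength, h.colLen_zero]
  omega

end IsCons

/-! ### Hook lengths of doubled distinct partitions -/

/-- The number of parts of `s` exceeding `v`, defined as the index of the first part that is at most
`v`. -/
def numGT (s : StrictPartition) (v : ℕ) : ℕ :=
  Nat.find (p := fun i => s.part i ≤ v)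
    ⟨s.parts.length, by rw [s.part_eq_zero le_rfl]; exact Nat.zero_le v⟩

theorem part_numGT_le (s : StrictPartition) (v : ℕ) : s.part (s.numGT v) ≤ v :=
  Nat.find_spec (p := fun i => s.part i ≤ v) _

theorem lt_part_of_lt_numGT (s : StrictPartition) {v i : ℕ} (h : i < s.numGT v) : v < s.part i :=
  not_le.mp (Nat.find_min (p := fun i => s.part i ≤ v) _ h)

theorem lt_part_iff (s : StrictPartition) {v i : ℕ} : v < s.part i ↔ i < s.numGT v := by
  refine ⟨fun h => ?_, s.lt_part_of_lt_numGT⟩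
  by_contra hi
  have := s.part_add_le (not_lt.mp hi) (by omega)
  have := s.part_numGT_le v
  omega

theorem part_numGT_lt (s : StrictPartition) {v : ℕ} (hv : v ∉ s.parts.toFinset)
    (h : 0 < s.part (s.numGT v)) : s.part (s.numGT v) < v := by
  refine lt_of_le_of_ne (s.part_numGT_le v) fun heq => hv ?_
  rw [List.mem_toFinset, ← heq]
  exact s.part_mem (s.part_pos_iff.mp h)

theorem length_le_add_numGT (s : StrictPartition) {v : ℕ} (hv : v ∉ s.parts.toFinset) :
    s.parts.length ≤ v + s.numGT v := by
  by_contra! hlt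
  have h1 : 0 < s.part (s.parts.length - 1) := s.part_pos_iff.mpr (by omega)
  have h2 := s.part_add_le (i := s.numGT v) (j := s.parts.length - 1) (by omega) h1
  have h3 := s.part_numGT_lt hv (s.part_pos_iff.mpr (by omega))
  omega

theorem add_numGT_lt (s : StrictPartition) {v v' : ℕ} (hv' : v' ∉ s.parts.toFinset)
    (h : v < v') : v + s.numGT v < v' + s.numGT v' := by
  by_contra! hle
  have h1 := s.lt_part_of_lt_numGT (v := v) (i := s.numGT v - 1) (by omega)
  have h2 := s.part_add_le (i := s.numGT v') (j := s.numGT v - 1) (by omega) (by omega)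
  have h3 := s.part_numGT_lt hv' (by
    have := s.lt_part_iff.mpr (show s.numGT v' < s.numGT v by omega)
    omega)
  omega

/-- As `v` runs through the numbers below the largest part that are not parts, `v + s.numGT v` runs
through the columns to the right of the diagonal block. -/
theorem colLen_add_numGT (s : StrictPartition) {v : ℕ} (hv : v ∉ s.parts.toFinset) :
    s.doubled.colLen (v + s.numGT v) = s.numGT v := by
  refine YoungDiagram.colLen_eq_of_forall fun i => ?_
  rw [mem_doubled, s.part_eq_zero (s.length_le_add_numGT hv)]
  rcases lt_or_ge i (s.numGT v) with hi | hi
  · have h1 := s.lt_part_of_lt_numGT (v := v) (i := s.numGT v - 1) (by omega)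
    have h2 := s.part_add_le (i := i) (j := s.numGT v - 1) (by omega) (by omega)
    omega
  · rcases Nat.eq_zero_or_pos (s.part i) with h0 | hpos
    · omega
    · have h1 := s.part_add_le hi hpos
      have h2 := s.part_numGT_lt hv (by omega)
      omega

theorem prod_range_sub_eq_factorial (a : ℕ) : ∏ v ∈ range a, (a - v) = a.factorial := by
  rw [← prod_range_add_one_eq_factorial, ← prod_range_reflect]
  refine prod_congr rfl fun v hv => ?_
  have := mem_range.mp hv
  omega

namespace IsCons

/-- In the first row, the hook lengths beyond the diagonal block are the differences `a - v` with
`v < a` not a part. -/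
theorem prod_hookLength_right (h : IsCons a s' s) :
    ∏ j ∈ Ico s.parts.length (a + 1), s.doubled.hookLength (0, j) =
      ∏ v ∈ range a \ s'.parts.toFinset, (a - v) := by
  have hmem : ∀ v ∈ range a \ s'.parts.toFinset, v < a ∧ v ∉ s.parts.toFinset := by
    intro v hv
    simp only [mem_sdiff, mem_range, List.mem_toFinset, h.parts_eq, List.mem_cons] at hv ⊢
    exact ⟨hv.1, not_or.mpr ⟨hv.1.ne, hv.2⟩⟩
  have hle : ∀ v < a, 1 ≤ s.numGT v ∧ v + s.numGT v ≤ a := by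
    intro v hv
    have h0 : 0 < s.numGT v := s.lt_part_iff.mp (by rwa [h.part_zero])
    have h1 := s.lt_part_of_lt_numGT (v := v) (i := s.numGT v - 1) (by omega)
    have h2 := s.part_add_le (i := 0) (j := s.numGT v - 1) (by omega) (by omega)
    rw [h.part_zero] at h2
    omega
  have hinj : Set.InjOn (fun v => v + s.numGT v)
      (range a \ s'.parts.toFinset : Finset ℕ) := by
    intro v hv v' hv' heq
    simp only at heq
    by_contra hne
    rcases lt_or_gt_of_ne hne with hlt | hlt
    · have := s.add_numGT_lt (hmem v' hv').2 hlt
      omega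
    · have := s.add_numGT_lt (hmem v hv).2 hlt
      omega
  have himage : (range a \ s'.parts.toFinset).image (fun v => v + s.numGT v) =
      Ico s.parts.length (a + 1) := by
    refine eq_of_subset_of_card_le ?_ ?_
    · intro j hj
      obtain ⟨v, hv, rfl⟩ := mem_image.mp hj
      exact mem_Ico.mpr ⟨s.length_le_add_numGT (hmem v hv).2,
        Nat.lt_succ_of_le (hle v (hmem v hv).1).2⟩
    · rw [card_image_of_injOn hinj, card_sdiff_of_subset, card_range, card_toFinset_parts,
        Nat.card_Ico, h.length_eq]
      · omega
      · exact fun t ht => mem_range.mpr (h.lt_of_mem ht)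
  rw [← himage, prod_image hinj]
  refine prod_congr rfl fun v hv => ?_
  obtain ⟨h1, h2⟩ := hle v (hmem v hv).1
  rw [h.hookLength_zero_left h2, s.colLen_add_numGT (hmem v hv).2]
  omega

theorem prod_hookLength_right_mul (h : IsCons a s' s) :
    (∏ j ∈ Ico s.parts.length (a + 1), s.doubled.hookLength (0, j)) *
      ∏ t ∈ s'.parts.toFinset, (a - t) = a.factorial := by
  rw [h.prod_hookLength_right, prod_sdiff fun t ht => mem_range.mpr (h.lt_of_mem ht),
    prod_range_sub_eq_factorial]

theorem hookLength_zero_length (h : IsCons a s' s) :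
    s.doubled.hookLength (0, s.parts.length) = a := by
  have hc : s.doubled.colLen s.parts.length = s.parts.length := by
    refine YoungDiagram.colLen_eq_of_forall fun i => ?_
    rw [mem_doubled, s.part_eq_zero le_rfl]
    refine ⟨fun hi => by omega, fun hi => Or.inl ⟨hi, ?_⟩⟩
    have h1 := s.part_pos_iff.mpr (show s.parts.length - 1 < s.parts.length by omega)
    have := s.part_add_le (i := i) (j := s.parts.length - 1) (by omega) h1
    omega
  have := h.length_le
  rw [h.hookLength_zero_left this, hc]
  omega

/-- The product of the hook lengths of the boxes in the first row or the first column is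
`2 a! ^ 2 ∏ ((a + t) / (a - t)) ^ 2`, the product over the parts `t` other than `a`. -/
theorem prod_first_hook (h : IsCons a s' s) :
    ((∏ j ∈ range (a + 1), s.doubled.hookLength (0, j)) *
        ∏ i ∈ Ico 1 a, s.doubled.hookLength (i, 0)) *
      (∏ t ∈ s'.parts.toFinset, (a - t)) ^ 2 =
    2 * a.factorial ^ 2 * (∏ t ∈ s'.parts.toFinset, (a + t)) ^ 2 := by
  have hlen := h.length_le
  have hlen' := h.length_eq
  have hpos := h.pos
  have hleft : ∏ j ∈ Ico 1 s.parts.length, s.doubled.hookLength (0, j) =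
      ∏ t ∈ s'.parts.toFinset, (a + t) := by
    rw [← s'.prod_part, prod_Ico_eq_prod_range, hlen', Nat.add_sub_cancel]
    refine prod_congr rfl fun i hi => ?_
    have hi := mem_range.mp hi
    rw [h.hookLength_zero_left (by omega), s.colLen_of_lt_length (by omega), Nat.add_comm 1 i,
      h.part_succ]
    omega
  have hdown : ∏ i ∈ Ico 1 s.parts.length, s.doubled.hookLength (i, 0) =
      ∏ t ∈ s'.parts.toFinset, (a + t) := by
    rw [← s'.prod_part, prod_Ico_eq_prod_range, hlen', Nat.add_sub_cancel]
    refine prod_congr rfl fun i hi => ?_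
    have hi := mem_range.mp hi
    rw [h.hookLength_zero_right (by omega), s.rowLen_of_lt_length (by omega), Nat.add_comm 1 i,
      h.part_succ]
    omega
  -- The hooks below the diagonal block in column `0` are those of row `0`, shifted by one box; the
  -- unmatched first one has length `a`.
  have hdown' : a * ∏ i ∈ Ico s.parts.length a, s.doubled.hookLength (i, 0) =
      ∏ j ∈ Ico s.parts.length (a + 1), s.doubled.hookLength (0, j) := by
    rw [prod_eq_prod_Ico_succ_bot (Nat.lt_succ_of_le hlen), h.hookLength_zero_length,
      ← prod_Ico_add']
    congr 1
    refine prod_congr rfl fun i hi => ?_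
    have hi := mem_Ico.mp hi
    rw [h.hookLength_zero_right hi.2, h.hookLength_zero_left (by omega),
      s.rowLen_of_length_le hi.1]
  have hrow : ∏ j ∈ range (a + 1), s.doubled.hookLength (0, j) =
      2 * a * (∏ t ∈ s'.parts.toFinset, (a + t)) *
        ∏ j ∈ Ico s.parts.length (a + 1), s.doubled.hookLength (0, j) := by
    rw [range_eq_Ico, prod_eq_prod_Ico_succ_bot (Nat.succ_pos a), h.hookLength_zero_zero,
      ← prod_Ico_consecutive _ (show 0 + 1 ≤ s.parts.length by omega)
        (show s.parts.length ≤ a + 1 by omega), hleft, mul_assoc,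
      mul_assoc]
    simp only [mul_assoc]
  have hcol : ∏ i ∈ Ico 1 a, s.doubled.hookLength (i, 0) =
      (∏ t ∈ s'.parts.toFinset, (a + t)) *
        ∏ i ∈ Ico s.parts.length a, s.doubled.hookLength (i, 0) := by
    rw [← prod_Ico_consecutive _ (show 1 ≤ s.parts.length by omega) hlen, hdown]
  rw [hrow, hcol, ← h.prod_hookLength_right_mul, ← hdown']
  ring

end IsCons

/-- The hook product of a doubled distinct partition, by removing the largest part repeatedly. -/
theorem inv_hookProduct_doubled (s : StrictPartition) :
    1 / (s.doubled.hookProduct : ℚ) = ShiftedPlancherel.weight s.parts.toFinset := by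
  obtain ⟨l, hl, hl'⟩ := s
  induction l with
  | nil =>
    simp [YoungDiagram.hookProduct, ShiftedPlancherel.weight, doubled, shiftedCells, addedCells]
  | cons a l ih =>
    set s' : StrictPartition := ⟨l, (List.pairwise_cons.mp hl).2,
      fun x hx => hl' x (List.mem_cons_of_mem a hx)⟩ with hs'
    set s : StrictPartition := ⟨a :: l, hl, hl'⟩ with hs
    have h : IsCons a s' s := ⟨rfl⟩
    have ha : a ∉ s'.parts.toFinset := fun hmem => lt_irrefl a (h.lt_of_mem hmem)
    have hprod : s.doubled.hookProduct =
        (∏ j ∈ range (a + 1), s.doubled.hookLength (0, j)) *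
          (∏ i ∈ Ico 1 a, s.doubled.hookLength (i, 0)) * s'.doubled.hookProduct := by
      rw [YoungDiagram.hookProduct, h.prod_cells, YoungDiagram.hookProduct]
      congr 1
      exact prod_congr rfl fun c hc => h.hookLength_succ hc
    have hfirst := congrArg (Nat.cast (R := ℚ)) h.prod_first_hook
    have hins : s.parts.toFinset = insert a s'.parts.toFinset := by simp [hs, hs']
    rw [hins, ShiftedPlancherel.weight_insert ha, ← ih, hprod]
    simp_rw [div_pow]
    rw [prod_div_distrib]
    have hsub : ((∏ t ∈ s'.parts.toFinset, (a - t) : ℕ) : ℚ) =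
        ∏ t ∈ s'.parts.toFinset, ((a : ℚ) - t) := by
      rw [Nat.cast_prod]
      exact prod_congr rfl fun t ht => Nat.cast_sub (h.lt_of_mem ht).le
    have hsub0 : ∏ t ∈ s'.parts.toFinset, ((a : ℚ) - t) ≠ 0 := by
      refine prod_ne_zero_iff.mpr fun t ht => sub_ne_zero.mpr ?_
      exact_mod_cast (h.lt_of_mem ht).ne'
    have hadd0 : ∏ t ∈ s'.parts.toFinset, ((a : ℚ) + t) ≠ 0 := by
      have := h.pos
      exact prod_ne_zero_iff.mpr fun t ht => by positivity
    have hW0 : (((∏ j ∈ range (a + 1), s.doubled.hookLength (0, j)) *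
        ∏ i ∈ Ico 1 a, s.doubled.hookLength (i, 0) : ℕ) : ℚ) ≠ 0 := by
      refine Nat.cast_ne_zero.mpr (mul_ne_zero ?_ ?_) <;>
        exact prod_ne_zero_iff.mpr fun _ _ => Nat.succ_ne_zero _
    rw [Nat.cast_mul, Nat.cast_pow, hsub] at hfirst
    push_cast at hfirst hW0 ⊢
    have hfirst' : (2 * (a.factorial : ℚ) ^ 2)⁻¹ * ((∏ t ∈ s'.parts.toFinset, ((a : ℚ) - t)) ^ 2 /
          (∏ t ∈ s'.parts.toFinset, ((a : ℚ) + t)) ^ 2) =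
        ((∏ j ∈ range (a + 1), (s.doubled.hookLength (0, j) : ℚ)) *
          ∏ i ∈ Ico 1 a, (s.doubled.hookLength (i, 0) : ℚ))⁻¹ := by
      have hf : (a.factorial : ℚ) ≠ 0 := by positivity
      refine eq_inv_of_mul_eq_one_left ?_
      generalize (∏ j ∈ range (a + 1), (s.doubled.hookLength (0, j) : ℚ)) *
          ∏ i ∈ Ico 1 a, (s.doubled.hookLength (i, 0) : ℚ) = W at *
      field_simp
      linear_combination hfirst
    rw [prod_pow, prod_pow, hfirst', one_div, mul_inv, mul_comm, one_div]

/-! ### Contents, and strict partitions as sets of parts -/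

/-- The contents contributed by a part `t` are `0, 1, …, t` and `-1, …, -(t - 1)`. -/
theorem sum_cells_content {M : Type*} [AddCommMonoid M] (s : StrictPartition) (f : ℤ → M) :
    ∑ c ∈ s.doubled.cells, f ((c.2 : ℤ) - (c.1 : ℤ)) =
      ∑ t ∈ s.parts.toFinset, (∑ j ∈ range (t + 1), f j + ∑ i ∈ Ico 1 t, f (-i)) := by
  obtain ⟨l, hl, hl'⟩ := s
  induction l with
  | nil => simp [doubled, shiftedCells, addedCells]
  | cons a l ih =>
    set s' : StrictPartition := ⟨l, (List.pairwise_cons.mp hl).2,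
      fun x hx => hl' x (List.mem_cons_of_mem a hx)⟩ with hs'
    set s : StrictPartition := ⟨a :: l, hl, hl'⟩ with hs
    have h : IsCons a s' s := ⟨rfl⟩
    have ha : a ∉ s'.parts.toFinset := fun hmem => lt_irrefl a (h.lt_of_mem hmem)
    have hins : s.parts.toFinset = insert a s'.parts.toFinset := by simp [hs, hs']
    rw [h.sum_cells, hins, sum_insert ha, ← ih]
    simp [hs']

theorem card_doubled (s : StrictPartition) :
    s.doubled.card = 2 * ∑ t ∈ s.parts.toFinset, t := by
  have h := s.sum_cells_content (fun _ => 1)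
  simp only [sum_const, smul_eq_mul, mul_one, card_range, Nat.card_Ico] at h
  rw [YoungDiagram.card, h, mul_sum]
  refine sum_congr rfl fun t ht => ?_
  have := s.pos t (List.mem_toFinset.mp ht)
  omega

theorem part_eq_colLen_sub (s : StrictPartition) (i : ℕ) :
    s.part i = s.doubled.colLen i - i := by
  rcases lt_or_ge i s.parts.length with h | h
  · rw [s.colLen_of_lt_length h]
    omega
  · have h1 : (i, i) ∉ s.doubled := by
      rw [mem_doubled, s.part_eq_zero h]
      omega
    rw [YoungDiagram.mem_iff_lt_colLen] at h1
    rw [s.part_eq_zero h]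
    omega

theorem doubled_injective : Function.Injective doubled := by
  intro s s' h
  have hpart (i : ℕ) : s.part i = s'.part i := by
    rw [part_eq_colLen_sub, part_eq_colLen_sub, h]
  have hlen : s.parts.length = s'.parts.length :=
    eq_of_forall_lt_iff fun i => by rw [← part_pos_iff, ← part_pos_iff, hpart]
  have hparts : s.parts = s'.parts := by
    refine List.ext_getElem hlen fun i h1 h2 => ?_
    simpa [part, List.getD_eq_getElem?_getD, h1, h2] using hpart i
  cases s
  cases s'
  simpa using hparts

/-- The strict partition with a given set of parts; an element `0` of the set is ignored. -/
def ofFinset (S : Finset ℕ) : StrictPartition where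
  parts := (S.erase 0).sort (· ≥ ·)
  strictlyDecreasing := (S.erase 0).sortedGT_sort.pairwise
  pos _ hx := Nat.pos_of_ne_zero (ne_of_mem_erase ((mem_sort _).mp hx))

theorem toFinset_parts_ofFinset {S : Finset ℕ} (hS : 0 ∉ S) :
    (ofFinset S).parts.toFinset = S := by
  rw [ofFinset, sort_toFinset, erase_eq_of_notMem hS]

theorem ofFinset_toFinset_parts (s : StrictPartition) : ofFinset s.parts.toFinset = s := by
  obtain ⟨l, hl, hl'⟩ := s
  have h : ((l.toFinset).erase 0).sort (· ≥ ·) = l := by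
    rw [erase_eq_of_notMem fun h => lt_irrefl 0 (hl' 0 (List.mem_toFinset.mp h))]
    exact (List.toFinset_sort (· ≥ ·) (hl.imp fun h => Nat.ne_of_gt h)).mpr
      (hl.imp fun h => le_of_lt h)
  simp only [ofFinset, h]

end StrictPartition

namespace ShiftedPlancherel

open Finset StrictPartition

/-! ### Averages over doubled distinct partitions -/

theorem mem_doubledDistinct {m : ℕ} {μ : YoungDiagram} :
    μ ∈ YoungDiagram.doubledDistinct m ↔ μ.IsDoubledDistinct ∧ μ.card = m := by
  simp [YoungDiagram.doubledDistinct]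

/-- Hook averages over doubled distinct partitions of size `2 * n` are averages over strict
partitions of `n`. -/
theorem sum_doubledDistinct (n : ℕ) (f : ℤ → ℚ) (g : Finset ℕ → ℚ)
    (hfg : ∀ S : Finset ℕ, 0 ∉ S →
      ∑ t ∈ S, (∑ j ∈ range (t + 1), f j + ∑ i ∈ Ico 1 t, f (-i)) = g S) :
    (2 : ℚ) ^ n * (n.factorial : ℚ) * ∑ μ ∈ YoungDiagram.doubledDistinct (2 * n),
      1 / (μ.hookProduct : ℚ) * (μ.contents.map f).sum = total n g := by
  rw [total]
  congr 1
  symm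
  refine sum_bij (fun S _ => (ofFinset S).doubled) ?_ ?_ ?_ ?_
  · intro S hS
    obtain ⟨h0, hn⟩ := mem_strictSets.mp hS
    rw [mem_doubledDistinct, card_doubled, toFinset_parts_ofFinset h0, hn]
    exact ⟨⟨_, rfl⟩, rfl⟩
  · intro S hS S' hS' h
    rw [← toFinset_parts_ofFinset (mem_strictSets.mp hS).1, doubled_injective h,
      toFinset_parts_ofFinset (mem_strictSets.mp hS').1]
  · intro μ hμ
    obtain ⟨⟨s, rfl⟩, hn⟩ := mem_doubledDistinct.mp hμ
    refine ⟨s.parts.toFinset, mem_strictSets.mpr ⟨s.zero_notMem_toFinset_parts, ?_⟩, ?_⟩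
    · rw [card_doubled] at hn
      omega
    · rw [ofFinset_toFinset_parts]
  · intro S hS
    have h0 := (mem_strictSets.mp hS).1
    rw [inv_hookProduct_doubled, YoungDiagram.contents, Multiset.map_map]
    have := (ofFinset S).sum_cells_content f
    rw [toFinset_parts_ofFinset h0, hfg S h0] at this
    rw [toFinset_parts_ofFinset h0, ← this]
    rfl

/-- The reflection `(-t + k - 1).choose (2 * k) = (t + k).choose (2 * k)`, by which the contents `-t`
and `t + 1` contribute equally. -/
theorem choose_neg_content (t k : ℕ) :
    Ring.choose (-(t : ℤ) + k - 1) (2 * k) = ((t + k).choose (2 * k) : ℤ) := by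
  rw [show -(t : ℤ) + k - 1 = -(t - k + 1) by ring, Ring.choose_neg', Ring.multichoose_eq,
    Int.negOnePow_even _ (by simp), one_smul,
    show (t : ℤ) - k + 1 + (2 * k : ℕ) - 1 = ((t + k : ℕ) : ℤ) by push_cast; ring,
    Ring.choose_natCast]

theorem choose_pos_content (t k : ℕ) :
    Ring.choose (((t + 1 : ℕ) : ℤ) + k - 1) (2 * k) = ((t + k).choose (2 * k) : ℤ) := by
  rw [show ((t + 1 : ℕ) : ℤ) + k - 1 = ((t + k : ℕ) : ℤ) by push_cast; ring, Ring.choose_natCast]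

theorem sum_choose_content (k t : ℕ) :
    (∑ j ∈ range (t + 1 + 1), Ring.choose ((j : ℤ) + k - 1) (2 * k) +
      ∑ i ∈ Ico 1 (t + 1), Ring.choose (-(i : ℤ) + k - 1) (2 * k)) =
        2 * ((t + 1 + k).choose (2 * k + 1) : ℤ) := by
  induction t with
  | zero =>
    have h0 := choose_neg_content 0 k
    rw [Nat.cast_zero, neg_zero] at h0
    rw [sum_range_succ, zero_add, sum_range_one, choose_pos_content, Nat.cast_zero, h0,
      Ico_self, sum_empty]
    rcases k with _ | k
    · simp
    · rw [Nat.choose_eq_zero_of_lt (by omega), Nat.choose_eq_zero_of_lt (by omega)]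
      simp
  | succ t ih =>
    rw [sum_range_succ, sum_Ico_succ_top (by omega), add_add_add_comm, ih, choose_pos_content,
      choose_neg_content, show t + 1 + 1 + k = t + 1 + k + 1 by omega, Nat.choose_succ_succ]
    push_cast
    ring

theorem sum_sq_content (t : ℕ) :
    (∑ j ∈ range (t + 1 + 1), (((j : ℕ) : ℤ) : ℚ) ^ 2 +
      ∑ i ∈ Ico 1 (t + 1), ((-(i : ℤ) : ℤ) : ℚ) ^ 2) =
        4 * ((t + 1 + 1).choose 3 : ℚ) + (t + 1) := by
  induction t with
  | zero => simp [sum_range_succ]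
  | succ t ih =>
    have hchoose : ((t + 1 + 1 + 1).choose 3 : ℚ) =
        (t + 1 + 1).choose 2 + (t + 1 + 1).choose 3 := by
      exact_mod_cast Nat.choose_succ_succ (t + 1 + 1) 2
    rw [sum_range_succ, sum_Ico_succ_top (by omega), add_add_add_comm, ih, hchoose,
      Nat.cast_choose_two]
    push_cast
    ring

end ShiftedPlancherel

theorem mainTheorem9 (n : ℕ) :
    (∀ k : ℕ,
      (2 : ℚ) ^ n * (n.factorial : ℚ) *
          ∑ μ ∈ YoungDiagram.doubledDistinct (2 * n),
            1 / (μ.hookProduct : ℚ) *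
              (μ.contents.map fun c : ℤ => ((Ring.choose (c + (k : ℤ) - 1) (2 * k) : ℤ) : ℚ)).sum =
        (2 : ℚ) ^ (k + 1) / ((k + 1).factorial : ℚ) * (n.choose (k + 1) : ℚ)) ∧
    (2 : ℚ) ^ n * (n.factorial : ℚ) *
        ∑ μ ∈ YoungDiagram.doubledDistinct (2 * n),
          1 / (μ.hookProduct : ℚ) * (μ.contents.map fun c : ℤ => (c : ℚ) ^ 2).sum =
      4 * (n.choose 2 : ℚ) + (n : ℚ) := by
  have hpred : ∀ {S : Finset ℕ} {t : ℕ}, 0 ∉ S → t ∈ S → ∃ u, t = u + 1 := fun h0 ht =>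
    Nat.exists_eq_succ_of_ne_zero fun h => h0 (h ▸ ht)
  constructor
  · intro k
    rw [ShiftedPlancherel.sum_doubledDistinct n _ ((2 : ℚ) • ShiftedPlancherel.chooseSum k),
      ShiftedPlancherel.total_smul, ShiftedPlancherel.total_chooseSum]
    · ring
    · intro S h0
      rw [Pi.smul_apply, ShiftedPlancherel.chooseSum, smul_eq_mul, Finset.mul_sum]
      refine Finset.sum_congr rfl fun t ht => ?_
      obtain ⟨u, rfl⟩ := hpred h0 ht
      exact_mod_cast ShiftedPlancherel.sum_choose_content k u
  · rw [ShiftedPlancherel.sum_doubledDistinct n _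
        ((4 : ℚ) • ShiftedPlancherel.chooseSum 1 + ShiftedPlancherel.chooseSum 0),
      ShiftedPlancherel.total_add, ShiftedPlancherel.total_smul,
      ShiftedPlancherel.total_chooseSum, ShiftedPlancherel.total_chooseSum]
    · simp
    · intro S h0
      rw [Pi.add_apply, Pi.smul_apply, ShiftedPlancherel.chooseSum, ShiftedPlancherel.chooseSum,
        smul_eq_mul, Finset.mul_sum, ← Finset.sum_add_distrib]
      refine Finset.sum_congr rfl fun t ht => ?_
      obtain ⟨u, rfl⟩ := hpred h0 ht
      rw [ShiftedPlancherel.sum_sq_content]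
      simp
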